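/- Let $\Sigma$ be a punctured surface of finite type in its compact form, i.e. a compact connected smooth surface with boundary which is homeomorphic to a closed connected orientable surface with finitely many (at least one) disjoint open discs removed (equivalently, to a closed disc with finitely many disjoint boundary arcs glued in pairs by orientation-reversing maps). Let $\varphi:\Sigma\to\Sigma$ be a $C^\infty$ diffeomorphism and let $N=\Sigma\times\mathbb R/\big((x,t+1)\sim(\varphi(x),t)\big)$ be the smooth surface bundle over $S^1$ with fibre $\Sigma$ and monodromy $\varphi$; thus $N$ is $\Sigma\times I$, $I=[0,1]$, with $(x,1)$ glued to $(\varphi(x),0)$. Let $x_0\in\Sigma$ and let $\rho:\pi_1(\Sigma,x_0)\to\mathrm{Homeo}(I)$ be a representation by orientation-preserving homeomorphisms. Call $\rho$ *generic* if for each nontrivial $\alpha\in\pi_1(\Sigma,x_0)$ the fixed points of $\rho(\alpha)$ in the interior of $I$ are isolated, and *well-tapered* if it is generic and its image consists of $C^\infty$ diffeomorphisms of $I$ that are infinitely tangent to the identity at both endpoints. A codimension one foliation (transverse to the boundary) is *typical* if for each leaf $\lambda$ the holonomy cover of $\lambda$, i.e. the connected covering of $\lambda$ corresponding to the kernel of the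 holonomy homomorphism from $\pi_1(\lambda)$ to germs of homeomorphisms of a transversal, is contractible. Suppose $\rho$ is generic. Then there is a typical codimension one topological foliation $\mathscr F_\rho$ of $N$ which on $\Sigma\times I$ is the suspension of $\rho$: for every path $c$ in $\Sigma$ and every $\theta\in I$ there is exactly one path $u$ in $I$ with $u(0)=\theta$ such that $s\mapsto (c(s),u(s))$ is tangent to $\mathscr F_\rho$, and if $c$ is a loop at $x_0$ in the class $\alpha$, then $u(1)=\rho(\alpha)(\theta)$. (Here the product $\alpha\beta$ in $\pi_1(\Sigma,x_0)$ is the loop $\beta$ followed by the loop $\alpha$.) If $\rho$ is well-tapered, $\mathscr F_\rho$ can moreover be chosen to be $C^\infty$. -/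

import Mathlib

open Set Filter Topology
open scoped Manifold ContDiff unitInterval

universe u

noncomputable section

/-! ## Punctured surfaces -/

/-- The rectangle `[0, 2m+1] × [0, 1]`.  On its top edge it carries the `m` pairwise disjoint closed
arcs `[2i+1, 2i+2] × {1}`, `i < m`. -/
def discWithArcs (m : ℕ) : Set (ℝ × ℝ) :=
  Icc (0 : ℝ) (2 * m + 1) ×ˢ Icc (0 : ℝ) 1

/-- The elementary identifications: the `i`-th arc is glued to the `τ i`-th arc by the
orientation-reversing isometry. -/
def arcGluing {m : ℕ} (τ : Fin m → Fin m) (a b : discWithArcs m) : Prop :=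
  ∃ (i : Fin m) (s : ℝ), s ∈ Icc (0 : ℝ) 1 ∧
    (a : ℝ × ℝ) = (2 * ((i : ℕ) : ℝ) + 1 + s, 1) ∧
    (b : ℝ × ℝ) = (2 * ((τ i : ℕ) : ℝ) + 2 - s, 1)

/-- A polygon with truncated corners whose sides are glued in pairs (with the quotient topology). -/
abbrev GluedDisc {m : ℕ} (τ : Fin m → Fin m) : Type := Quot (arcGluing τ)

/-- `S` is a punctured surface of finite type, in its compact form: a closed connected orientable
surface from which a positive number of disjoint open discs has been removed.  These are exactly the
spaces obtained from a disc by gluing finitely many disjoint boundary arcs in pairs, reversing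
orientation (`m = 0` is the disc; `m = 4g` with the pattern `a b a⁻¹ b⁻¹ ⋯` is the usual polygon of
the closed surface of genus `g`, with a disc around the vertex removed). -/
def IsPuncturedSurface (S : Type*) [TopologicalSpace S] : Prop :=
  ∃ (m : ℕ) (τ : Fin m → Fin m), (∀ i, τ (τ i) = i) ∧ (∀ i, τ i ≠ i) ∧ Nonempty (S ≃ₜ GluedDisc τ)

/-! ## Surface bundles over the circle -/

/-- The local model of a surface with boundary times a line. -/
abbrev HalfSpaceProd : Type := ModelProd (EuclideanHalfSpace 2) ℝ

/-- `q : S × ℝ → N` exhibits the smooth manifold `N` as the mapping torus of `φ`, that is, as the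
surface bundle over the circle with fibre `S` and monodromy `φ`: the manifold `N` is the quotient of
`S × ℝ` by the action of `ℤ` generated by `(x, t + 1) ∼ (φ x, t)`. In particular `N` is
`S × [0, 1]` with `(x, 1)` glued to `(φ x, 0)`. -/
structure IsMappingTorus {S N : Type*} [TopologicalSpace S] [ChartedSpace (EuclideanHalfSpace 2) S]
    [TopologicalSpace N] [ChartedSpace HalfSpaceProd N]
    (φ : S ≃ₘ^∞⟮𝓡∂ 2, 𝓡∂ 2⟯ S) (q : S × ℝ → N) : Prop where
  surjective : Function.Surjective q
  localDiffeo : IsLocalDiffeomorph ((𝓡∂ 2).prod 𝓘(ℝ, ℝ)) ((𝓡∂ 2).prod 𝓘(ℝ, ℝ)) ∞ q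
  eq_iff : ∀ (x y : S) (t s : ℝ), q (x, t) = q (y, s) ↔
    ∃ n : ℤ, y = ((φ.toEquiv : Equiv.Perm S) ^ n) x ∧ s = t - n

/-! ## Representations in the homeomorphisms of the interval -/

/-- For each nontrivial `γ`, the fixed points of `ρ γ` in the interior of `I` are isolated. -/
def IsGeneric {G : Type*} [Group G] (ρ : G →* (I ≃ₜ I)) : Prop :=
  ∀ γ : G, γ ≠ 1 → ∀ θ : I, 0 < θ → θ < 1 → ρ γ θ = θ → ∀ᶠ θ' in 𝓝[≠] θ, ρ γ θ' ≠ θ'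

/-- A self-homeomorphism of `I` as a real function (constant outside `I`). -/
def realExtension (g : I ≃ₜ I) (t : ℝ) : ℝ := (g (projIcc 0 1 zero_le_one t) : ℝ)

/-- `g` is a `C^∞` diffeomorphism of `I`, infinitely tangent to the identity at both endpoints. -/
structure IsTaperedDiffeo (g : I ≃ₜ I) : Prop where
  smooth : ContDiffOn ℝ ∞ (realExtension g) (Icc 0 1)
  smooth_symm : ContDiffOn ℝ ∞ (realExtension g.symm) (Icc 0 1)
  tangent_zero : ∀ n : ℕ, iteratedDerivWithin n (fun t => realExtension g t - t) (Icc 0 1) 0 = 0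
  tangent_one : ∀ n : ℕ, iteratedDerivWithin n (fun t => realExtension g t - t) (Icc 0 1) 1 = 0

/-- A generic representation by `C^∞` diffeomorphisms infinitely tangent to the identity at the
endpoints. -/
def IsWellTapered {G : Type*} [Group G] (ρ : G →* (I ≃ₜ I)) : Prop :=
  IsGeneric ρ ∧ ∀ γ, IsTaperedDiffeo (ρ γ)

/-! ## Surface foliations of three-manifolds -/

/-- A (topological) codimension one foliation of a three-manifold, transverse to its boundary, given
by an atlas of foliated charts: the changes of charts have locally the form
`(x, t) ↦ (f (x, t), h t)`. -/
structure SurfaceFoliation (N : Type*) [TopologicalSpace N] where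
  charts : Set (OpenPartialHomeomorph N HalfSpaceProd)
  cover : ∀ x : N, ∃ e ∈ charts, x ∈ e.source
  compatible : ∀ e ∈ charts, ∀ e' ∈ charts, ∀ x ∈ e.source ∩ e'.source,
    ∃ h : ℝ → ℝ, ∀ᶠ y in 𝓝 x, (e' y).2 = h (e y).2

namespace SurfaceFoliation

section TopologicalPart

variable {N : Type*} [TopologicalSpace N]

/-- The leaf topology: it is generated by the open subsets of the plaques
`{y ∈ e.source | (e y).2 = t}`. -/
@[reducible] def leafTopology (F : SurfaceFoliation N) : TopologicalSpace N :=
  TopologicalSpace.generateFrom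
    {W | ∃ e ∈ F.charts, ∃ (t : ℝ) (V : Set N), IsOpen V ∧
      W = {y | y ∈ e.source ∧ (e y).2 = t ∧ y ∈ V}}

/-- The manifold `N` with the leaf topology. -/
def LeafSpace (_F : SurfaceFoliation N) : Type _ := N

instance (F : SurfaceFoliation N) : TopologicalSpace F.LeafSpace := F.leafTopology

/-- The leaf through `x`; as a type it carries the leaf topology. -/
def leaf (F : SurfaceFoliation N) (x : N) : Set F.LeafSpace :=
  pathComponent (X := F.LeafSpace) x

/-- The path `c` is tangent to the foliation (that is, continuous for the leaf topology). -/
def IsLeafwise (F : SurfaceFoliation N) (c : I → N) : Prop :=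
  Continuous (Y := F.LeafSpace) c

/-- The germ at `(e (c 0)).2` of `g` is the holonomy of `F` along the leafwise path `c`, between the
transversal through `c 0` that is vertical in the chart `e` and the transversal through `c 1` that
is vertical in the chart `e'`: the path `c` can be moved to nearby leaves by a
continuous family `H (·, t)` of leafwise paths starting at the point of height `t` of the first
transversal and ending at the point of height `g t` of the second one. -/
def HasHolonomy (F : SurfaceFoliation N) (c : I → N) (e e' : OpenPartialHomeomorph N HalfSpaceProd)
    (g : ℝ → ℝ) : Prop :=
  ∃ δ > (0 : ℝ), ∃ H : I × ℝ → N,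
    ContinuousOn H (univ ×ˢ Metric.ball (e (c 0)).2 δ) ∧
    (∀ s, H (s, (e (c 0)).2) = c s) ∧
    ∀ t ∈ Metric.ball (e (c 0)).2 δ,
      F.IsLeafwise (fun s => H (s, t)) ∧
      (((e (c 0)).1, t) ∈ e.target ∧ H (0, t) = e.symm ((e (c 0)).1, t)) ∧
      (((e' (c 1)).1, g t) ∈ e'.target ∧ H (1, t) = e'.symm ((e' (c 1)).1, g t))

/-- The leafwise loop `c` lies in the kernel of the holonomy homomorphism: its holonomy on a
transversal through `c 0` is the germ of the identity. -/
def HasTrivialHolonomy (F : SurfaceFoliation N) (c : I → N) : Prop :=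
  ∃ e ∈ F.charts, c 0 ∈ e.source ∧ F.HasHolonomy c e e id

/-- `pr : E → λ` is the holonomy cover of the leaf `λ` through `x`: the connected covering which
corresponds to the kernel of the holonomy homomorphism, that is, a loop in the leaf lifts to a closed
loop in `E` if and only if its holonomy is trivial. -/
structure IsHolonomyCover (F : SurfaceFoliation N) (x : N) {E : Type*} [TopologicalSpace E]
    (pr : E → F.leaf x) : Prop where
  isCoveringMap : IsCoveringMap pr
  pathConnected : PathConnectedSpace E
  closed_iff : ∀ Γ : C(I, E), pr (Γ 0) = pr (Γ 1) →
    (Γ 0 = Γ 1 ↔ F.HasTrivialHolonomy (fun s => ((pr (Γ s) : F.LeafSpace) : N)))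

/-- A foliation is typical if the holonomy cover of each leaf is contractible. -/
def IsTypical {N : Type u} [TopologicalSpace N] (F : SurfaceFoliation N) : Prop :=
  ∀ x : N, ∃ (E : Type u) (_ : TopologicalSpace E) (pr : E → F.leaf x),
    F.IsHolonomyCover x pr ∧ ContractibleSpace E

/-- Cutting the mapping torus `N` open along the fibre `q (S × {0})` turns `F` into the suspension of
`ρ` on `S × I`, that is, into the foliation transverse to the intervals `{x} × I` with holonomy
representation `ρ`: through each point over `c 0` there is exactly one leafwise lift to `S × I` of a
path `c` in `S`, and the lift of a loop `γ` at `x₀` that starts at height `θ` ends at height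
`ρ γ θ`.  (In Mathlib the product `γ * γ'` in the fundamental group is `γ'` followed by `γ`, so that
this is a left action.) -/
structure IsSuspension {S : Type*} [TopologicalSpace S] (F : SurfaceFoliation N) (q : S × ℝ → N)
    {x₀ : S} (ρ : FundamentalGroup S x₀ →* (I ≃ₜ I)) : Prop where
  existsUnique_lift : ∀ (c : C(I, S)) (θ : I), ∃! u : C(I, I),
    u 0 = θ ∧ F.IsLeafwise (fun s => q (c s, (u s : ℝ)))
  holonomy : ∀ (γ : Path x₀ x₀) (u : C(I, I)), F.IsLeafwise (fun s => q (γ s, (u s : ℝ))) →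
    u 1 = ρ (FundamentalGroup.fromPath (Path.Homotopic.Quotient.mk γ)) (u 0)

end TopologicalPart

/-- A foliation of a smooth manifold is `C^∞` if its foliated charts are smooth charts. -/
def IsSmooth {N : Type*} [TopologicalSpace N] [ChartedSpace HalfSpaceProd N]
    (F : SurfaceFoliation N) : Prop :=
  ∀ e ∈ F.charts, e ∈ IsManifold.maximalAtlas ((𝓡∂ 2).prod 𝓘(ℝ, ℝ)) ∞ N

end SurfaceFoliation

end

/-
Cut along its glued arcs, the surface `S` is a disc, so its universal cover `E` is a tree of discs.
Contracting each disc along the arc that leads towards the root shows that `E` is contractible.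

For every sheet over a small open subset of `S`, identified with a deck transformation `g`, the leaf
of height `θ ∈ I` of the suspension of `ρ` has height `ρ g θ`. A partition of unity on `S`
interpolates these heights to functions on `E` that are equivariant under the deck group, and the
lifts of the monodromy propagate them to all of `E × ℝ`. The resulting developing map
`E × ℝ → N` is a covering whose deck transformations preserve the horizontal foliation, so that this
foliation descends to `N`.

A leaf of the quotient is the quotient of `E` by the stabilizer of a height. By genericity, a deck
transformation that fixes all nearby heights is trivial. Hence a loop in a leaf has trivial holonomy
if and only if it lifts to a loop in `E`, so that `E` is the holonomy cover of each leaf. If the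
homeomorphisms `ρ γ` are infinitely tangent to the identity at the endpoints, the pieces of the
developing map over the intervals `[n, n + 1]` fit together smoothly.
-/

noncomputable section

/-! ## Quotients by a relation that composes only with its inverse -/

section Quotient

lemma quot_mk_eq_iff_eq_or_rel {X : Type*} {r : X → X → Prop} (symm : ∀ {a b}, r a b → r b a)
    (eq_of_rel_of_rel : ∀ {a b c}, r a b → r b c → a = c) {a b : X} :
    Quot.mk r a = Quot.mk r b ↔ a = b ∨ r a b := by
  have equivalence : Equivalence fun a b => a = b ∨ r a b :=
    { refl := fun a => Or.inl rfl
      symm := fun h => h.imp Eq.symm symm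
      trans := by
        rintro a b c (rfl | hab) (rfl | hbc)
        exacts [Or.inl rfl, Or.inr hbc, Or.inr hab, Or.inl (eq_of_rel_of_rel hab hbc)] }
  rw [Quot.eq]
  refine ⟨fun h => equivalence.eqvGen_iff.1 (h.mono fun _ _ => Or.inr), ?_⟩
  rintro (rfl | h)
  exacts [.refl _, .rel _ _ h]

variable {X : Type*} [TopologicalSpace X] [CompactSpace X] {r : X → X → Prop}

lemma isClosedMap_quot_mk (closed : IsClosed {p : X × X | Quot.mk r p.1 = Quot.mk r p.2}) :
    IsClosedMap (Quot.mk r) := by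
  intro C hC
  rw [← isQuotientMap_quot_mk.isClosed_preimage]
  have saturation : Quot.mk r ⁻¹' (Quot.mk r '' C) =
      Prod.snd '' ({p : X × X | Quot.mk r p.1 = Quot.mk r p.2} ∩ Prod.fst ⁻¹' C) := by
    ext b
    simp [and_comm]
  rw [saturation]
  exact isClosedMap_snd_of_compactSpace _ (closed.inter (hC.preimage continuous_fst))

lemma t2Space_quot [T2Space X] (closed : IsClosed {p : X × X | Quot.mk r p.1 = Quot.mk r p.2}) :
    T2Space (Quot r) := by
  have closedMap := isClosedMap_quot_mk closed
  have isClosed_fiber (x : X) : IsClosed (Quot.mk r ⁻¹' {Quot.mk r x}) := by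
    simpa only [image_singleton] using
      (closedMap _ (isClosed_singleton (x := x))).preimage continuous_quot_mk
  rw [t2Space_iff_disjoint_nhds]
  rintro ⟨a⟩ ⟨b⟩ hab
  obtain ⟨U, V, hU, hV, haU, hbV, hUV⟩ := SeparatedNhds.of_isCompact_isCompact
    (isClosed_fiber a).isCompact (isClosed_fiber b).isCompact
    (disjoint_singleton.2 hab |>.preimage _)
  have mem_nhds {x : X} {W : Set X} (hW : IsOpen W) (hx : Quot.mk r ⁻¹' {Quot.mk r x} ⊆ W) :
      kernImage (Quot.mk r) W ∈ 𝓝 (Quot.mk r x) :=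
    (isClosedMap_iff_kernImage.1 closedMap hW).mem_nhds fun _ h => hx h
  refine Filter.disjoint_of_disjoint_of_mem ?_ (mem_nhds hU haU) (mem_nhds hV hbV)
  refine disjoint_left.2 ?_
  rintro ⟨c⟩ hcU hcV
  exact disjoint_left.1 hUV (hcU rfl) (hcV rfl)

end Quotient

/-! ## The glued disc -/

section GluedDisc

variable {m : ℕ} {τ : Fin m → Fin m}

/-- The point with parameter `s` on the `i`-th boundary arc of the rectangle. -/
def arcPoint (i : Fin m) (s : I) : discWithArcs m :=
  ⟨(2 * ((i : ℕ) : ℝ) + 1 + s, 1), by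
    have hi : ((i : ℕ) : ℝ) + 1 ≤ m := by exact_mod_cast i.2
    have hs := s.2
    simp only [discWithArcs, mem_prod, mem_Icc] at hs ⊢
    refine ⟨⟨?_, ?_⟩, ?_, ?_⟩ <;> linarith [Nat.cast_nonneg (α := ℝ) i]⟩

lemma arcPoint_fst (i : Fin m) (s : I) : (arcPoint i s).1.1 = 2 * ((i : ℕ) : ℝ) + 1 + s := rfl

/-- A vertical strip around the `i`-th arc; these strips are pairwise disjoint. -/
def arcStrip (i : Fin m) : Set (discWithArcs m) :=
  {a | a.1.1 ∈ Ioo (2 * ((i : ℕ) : ℝ) + 1 / 2) (2 * ((i : ℕ) : ℝ) + 5 / 2)}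

lemma isOpen_arcStrip (i : Fin m) : IsOpen (arcStrip i) :=
  isOpen_Ioo.preimage (continuous_fst.comp continuous_subtype_val)

lemma eq_of_mem_arcStrip {i j : Fin m} {a : discWithArcs m}
    (hi : a ∈ arcStrip i) (hj : a ∈ arcStrip j) : i = j := by
  simp only [arcStrip, mem_ofPred_eq, mem_Ioo] at hi hj
  have hij : ((i : ℕ) : ℝ) < ((j + 1 : ℕ) : ℝ) := by push_cast; linarith
  have hji : ((j : ℕ) : ℝ) < ((i + 1 : ℕ) : ℝ) := by push_cast; linarith
  rw [Nat.cast_lt] at hij hji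
  exact Fin.ext (by omega)

lemma arcPoint_mem_arcStrip (i : Fin m) (s : I) : arcPoint i s ∈ arcStrip i := by
  have hs := s.2
  simp only [arcStrip, mem_ofPred_eq, mem_Ioo, arcPoint_fst, mem_Icc] at hs ⊢
  constructor <;> linarith

lemma arcPoint_inj {i j : Fin m} {s t : I} : arcPoint i s = arcPoint j t ↔ i = j ∧ s = t := by
  refine ⟨fun h => ?_, by rintro ⟨rfl, rfl⟩; rfl⟩
  obtain rfl : i = j :=
    eq_of_mem_arcStrip (arcPoint_mem_arcStrip i s) (h ▸ arcPoint_mem_arcStrip j t)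
  simpa [arcPoint, SetCoe.ext_iff] using h

lemma continuous_arcPoint (i : Fin m) : Continuous (arcPoint i) := by
  unfold arcPoint
  fun_prop

lemma arcGluing_iff {a b : discWithArcs m} :
    arcGluing τ a b ↔ ∃ i s, a = arcPoint i s ∧ b = arcPoint (τ i) (σ s) := by
  have reversed (i : Fin m) (s : I) :
      (arcPoint i (σ s) : ℝ × ℝ) = (2 * ((i : ℕ) : ℝ) + 2 - s, 1) := by
    simp only [arcPoint, unitInterval.coe_symm_eq, Prod.mk.injEq, and_true]
    ring
  constructor
  · rintro ⟨i, s, hs, ha, hb⟩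
    exact ⟨i, ⟨s, hs⟩, Subtype.ext ha, Subtype.ext (hb.trans (reversed (τ i) ⟨s, hs⟩).symm)⟩
  · rintro ⟨i, s, rfl, rfl⟩
    exact ⟨i, s, s.2, rfl, reversed (τ i) s⟩

lemma arcGluing_symm (hτ : Function.Involutive τ) {a b : discWithArcs m} (h : arcGluing τ a b) :
    arcGluing τ b a := by
  obtain ⟨i, s, rfl, rfl⟩ := arcGluing_iff.1 h
  exact arcGluing_iff.2 ⟨τ i, σ s, rfl, by rw [hτ, unitInterval.symm_symm]⟩

lemma eq_of_arcGluing_of_arcGluing (hτ : Function.Involutive τ) {a b c : discWithArcs m}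
    (hab : arcGluing τ a b) (hbc : arcGluing τ b c) : a = c := by
  obtain ⟨i, s, rfl, hb⟩ := arcGluing_iff.1 hab
  obtain ⟨j, t, hb', rfl⟩ := arcGluing_iff.1 hbc
  obtain ⟨rfl, rfl⟩ := arcPoint_inj.1 (hb.symm.trans hb')
  rw [hτ, unitInterval.symm_symm]

lemma gluedDisc_mk_eq_iff (hτ : Function.Involutive τ) {a b : discWithArcs m} :
    (Quot.mk _ a : GluedDisc τ) = Quot.mk _ b ↔ a = b ∨ arcGluing τ a b :=
  quot_mk_eq_iff_eq_or_rel (arcGluing_symm hτ) (eq_of_arcGluing_of_arcGluing hτ)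

instance : CompactSpace (discWithArcs m) :=
  isCompact_iff_compactSpace.1 (isCompact_Icc.prod isCompact_Icc)

lemma gluedDisc_t2Space (hτ : Function.Involutive τ) : T2Space (GluedDisc τ) := by
  refine t2Space_quot ?_
  have graph : {p : discWithArcs m × discWithArcs m |
        (Quot.mk _ p.1 : GluedDisc τ) = Quot.mk _ p.2} =
      diagonal _ ∪ ⋃ i, range fun s => (arcPoint i s, arcPoint (τ i) (σ s)) := by
    ext ⟨a, b⟩
    simp only [mem_ofPred_eq, gluedDisc_mk_eq_iff hτ, arcGluing_iff, mem_union, mem_diagonal_iff,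
      mem_iUnion, mem_range, Prod.mk.injEq, eq_comm]
  rw [graph]
  refine isClosed_diagonal.union (isClosed_iUnion_of_finite fun i => ?_)
  exact (isCompact_range ((continuous_arcPoint i).prodMk
    ((continuous_arcPoint (τ i)).comp unitInterval.continuous_symm))).isClosed

end GluedDisc

/-! ## The tree of discs -/

section TreeCover

variable {m : ℕ}

/-- The generators of the deck group of the tree of discs, one for each pair of arcs glued
by `τ`. -/
abbrev ArcPair (τ : Fin m → Fin m) : Type := {i : Fin m // i < τ i}

variable {τ : Fin m → Fin m}

/-- The arc through which a letter (a generator or its inverse) leaves the disc. -/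
def letterArc (l : ArcPair τ × Bool) : Fin m := if l.2 then l.1.1 else τ l.1.1

/-- The formal inverse of a letter. -/
def letterInv (l : ArcPair τ × Bool) : ArcPair τ × Bool := (l.1, !l.2)

@[simp] lemma letterInv_letterInv (l : ArcPair τ × Bool) : letterInv (letterInv l) = l := by
  simp [letterInv]

lemma letterArc_letterInv (hτ : Function.Involutive τ) (l : ArcPair τ × Bool) :
    letterArc (letterInv l) = τ (letterArc l) := by
  rcases l with ⟨i, _ | _⟩ <;> simp [letterArc, letterInv, hτ _]

lemma letterArc_injective (hτ : Function.Involutive τ) :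
    Function.Injective (letterArc (τ := τ)) := by
  rintro ⟨⟨i, hi⟩, _ | _⟩ ⟨⟨j, hj⟩, _ | _⟩ h <;>
    simp only [letterArc, if_true, if_false, Bool.false_eq_true] at h
  · obtain rfl := hτ.injective h
    rfl
  · subst h
    exact absurd hi (hτ i ▸ hj).not_gt
  · subst h
    exact absurd hj (hτ j ▸ hi).not_gt
  · subst h
    rfl

lemma letterArc_surjective (hτ : Function.Involutive τ) (hτ' : ∀ i, τ i ≠ i) :
    Function.Surjective (letterArc (τ := τ)) := by
  intro i
  rcases lt_or_gt_of_ne (hτ' i) with h | h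
  · exact ⟨(⟨τ i, by rwa [hτ]⟩, false), by simp [letterArc, hτ i]⟩
  · exact ⟨(⟨i, h⟩, true), by simp [letterArc]⟩

/-- The element of the free group given by a letter. -/
def letterElt (l : ArcPair τ × Bool) : FreeGroup (ArcPair τ) := FreeGroup.mk [l]

lemma letterElt_letterInv (l : ArcPair τ × Bool) : letterElt (letterInv l) = (letterElt l)⁻¹ := by
  simp [letterElt, letterInv, FreeGroup.inv_mk, FreeGroup.invRev]

lemma letterElt_mul_mk (l : ArcPair τ × Bool) (L : List (ArcPair τ × Bool)) :
    letterElt l * FreeGroup.mk L = FreeGroup.mk (l :: L) := by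
  simp [letterElt, FreeGroup.mul_mk]

/-- The disjoint union of copies of the rectangle, indexed by the free group. -/
abbrev Sheets (τ : Fin m → Fin m) : Type := Σ _ : FreeGroup (ArcPair τ), discWithArcs m

/-- The arc of a letter `l` on the sheet `w` is glued to the inverse arc on the sheet `l w`. -/
def sheetGluing (p q : Sheets τ) : Prop :=
  ∃ (l : ArcPair τ × Bool) (s : I), p.2 = arcPoint (letterArc l) s ∧
    q.2 = arcPoint (letterArc (letterInv l)) (σ s) ∧ q.1 = letterElt l * p.1

lemma sheetGluing.symm {p q : Sheets τ} (h : sheetGluing p q) : sheetGluing q p := by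
  obtain ⟨l, s, hp, hq, hpq⟩ := h
  exact ⟨letterInv l, σ s, hq, by simpa using hp, by simp [hpq, letterElt_letterInv]⟩

lemma sheetGluing.eq_of_sheetGluing (hτ : Function.Involutive τ) {p q r : Sheets τ}
    (hpq : sheetGluing p q) (hqr : sheetGluing q r) : p = r := by
  obtain ⟨w, a⟩ := p
  obtain ⟨w', b⟩ := q
  obtain ⟨w'', c⟩ := r
  obtain ⟨l, s, rfl, hb, rfl⟩ := hpq
  obtain ⟨l', t, hb', rfl, rfl⟩ := hqr
  obtain ⟨hl, rfl⟩ := arcPoint_inj.1 (hb.symm.trans hb')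
  obtain rfl := letterArc_injective hτ hl
  simp [letterElt_letterInv]

lemma sheetGluing.arcGluing (hτ : Function.Involutive τ) {p q : Sheets τ} (h : sheetGluing p q) :
    arcGluing τ p.2 q.2 := by
  obtain ⟨l, s, hp, hq, -⟩ := h
  exact arcGluing_iff.2 ⟨_, s, hp, by rw [hq, letterArc_letterInv hτ]⟩

/-- The tree of discs: a copy of the rectangle for each element of the free group, glued along the
edges of the Cayley graph. -/
abbrev TreeCover (τ : Fin m → Fin m) : Type := Quot (sheetGluing (τ := τ))

lemma treeCover_mk_eq_iff (hτ : Function.Involutive τ) {p q : Sheets τ} :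
    (Quot.mk _ p : TreeCover τ) = Quot.mk _ q ↔ p = q ∨ sheetGluing p q :=
  quot_mk_eq_iff_eq_or_rel sheetGluing.symm (sheetGluing.eq_of_sheetGluing hτ)

lemma continuous_sheetMk (w : FreeGroup (ArcPair τ)) :
    Continuous fun a : discWithArcs m => (⟨w, a⟩ : Sheets τ) :=
  @continuous_sigmaMk _ (fun _ => discWithArcs m) _ w

/-- The deck transformation of the sheets given by `g`. It translates on the right because the
gluing multiplies by letters on the left. -/
def sheetTranslate (g : FreeGroup (ArcPair τ)) (p : Sheets τ) : Sheets τ := ⟨p.1 * g⁻¹, p.2⟩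

lemma continuous_sheetTranslate (g : FreeGroup (ArcPair τ)) : Continuous (sheetTranslate g) :=
  continuous_sigma fun w => continuous_sheetMk (w * g⁻¹)

lemma sheetGluing.translate (g : FreeGroup (ArcPair τ)) {p q : Sheets τ} (h : sheetGluing p q) :
    sheetGluing (sheetTranslate g p) (sheetTranslate g q) := by
  obtain ⟨l, s, hp, hq, hpq⟩ := h
  exact ⟨l, s, hp, hq, by simp only [sheetTranslate, hpq, mul_assoc]⟩

instance : MulAction (FreeGroup (ArcPair τ)) (TreeCover τ) where
  smul g := Quot.map (sheetTranslate g) fun _ _ => sheetGluing.translate g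
  one_smul := by
    rintro ⟨p⟩
    change Quot.mk _ (sheetTranslate 1 p) = _
    simp [sheetTranslate]
  mul_smul := by
    rintro g h ⟨p⟩
    change Quot.mk _ (sheetTranslate (g * h) p) = Quot.mk _ (sheetTranslate g (sheetTranslate h p))
    simp [sheetTranslate, mul_assoc]

lemma smul_treeCover_mk (g : FreeGroup (ArcPair τ)) (p : Sheets τ) :
    g • (Quot.mk _ p : TreeCover τ) = Quot.mk _ (sheetTranslate g p) := rfl

instance : ContinuousConstSMul (FreeGroup (ArcPair τ)) (TreeCover τ) where
  continuous_const_smul g := isQuotientMap_quot_mk.continuous_iff.2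
    (continuous_quot_mk.comp (continuous_sheetTranslate g))

/-- The projection of the tree of discs to the glued disc. -/
def treeProj (hτ : Function.Involutive τ) : TreeCover τ → GluedDisc τ :=
  Quot.map (fun p => p.2) fun _ _ h => h.arcGluing hτ

lemma isQuotientMap_treeProj (hτ : Function.Involutive τ) : IsQuotientMap (treeProj hτ) := by
  have continuous_treeProj : Continuous (treeProj hτ) := isQuotientMap_quot_mk.continuous_iff.2
    (continuous_quot_mk.comp (continuous_sigma fun _ => continuous_id))
  exact .of_comp (f := fun a => (Quot.mk _ ⟨1, a⟩ : TreeCover τ))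
    (continuous_quot_mk.comp (continuous_sheetMk 1)) continuous_treeProj isQuotientMap_quot_mk

lemma treeProj_eq_iff (hτ : Function.Involutive τ) (hτ' : ∀ i, τ i ≠ i) {e e' : TreeCover τ} :
    treeProj hτ e = treeProj hτ e' ↔ e ∈ MulAction.orbit (FreeGroup (ArcPair τ)) e' := by
  constructor
  · obtain ⟨⟨w, a⟩⟩ := e
    obtain ⟨⟨w', a'⟩⟩ := e'
    intro h
    obtain rfl | glued : a = a' ∨ arcGluing τ a a' := (gluedDisc_mk_eq_iff hτ).1 h
    · exact ⟨w⁻¹ * w', by simp [smul_treeCover_mk, sheetTranslate]⟩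
    · obtain ⟨i, s, rfl, rfl⟩ := arcGluing_iff.1 glued
      obtain ⟨l, rfl⟩ := letterArc_surjective hτ hτ' i
      refine ⟨(letterElt l * w)⁻¹ * w', Eq.symm (Quot.sound ⟨l, s, rfl, ?_, ?_⟩)⟩
      · simp [sheetTranslate, letterArc_letterInv hτ]
      · simp [sheetTranslate]
  · rintro ⟨g, rfl⟩
    obtain ⟨p⟩ := e'
    rfl

lemma treeCover_exists_nhds_of_saturated (hτ : Function.Involutive τ) {T : Set (Sheets τ)}
    (hT : IsOpen T) (saturated : ∀ {p q}, sheetGluing p q → p ∈ T → q ∈ T)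
    (sheet_eq : ∀ p ∈ T, ∀ q ∈ T, p.2 = q.2 → p.1 = q.1) {p : Sheets τ} (hp : p ∈ T) :
    ∃ U ∈ 𝓝 (Quot.mk _ p : TreeCover τ),
      ∀ g : FreeGroup (ArcPair τ), ((g • ·) '' U ∩ U).Nonempty → g = 1 := by
  have preimage_image : Quot.mk sheetGluing ⁻¹' (Quot.mk sheetGluing '' T) = T := by
    refine Subset.antisymm ?_ (subset_preimage_image _ _)
    rintro q ⟨p, hp, hpq⟩
    rcases (treeCover_mk_eq_iff hτ).1 hpq with rfl | h
    exacts [hp, saturated h hp]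
  refine ⟨Quot.mk _ '' T, IsOpen.mem_nhds ?_ ⟨p, hp, rfl⟩, ?_⟩
  · rwa [← isQuotientMap_quot_mk.isOpen_preimage, preimage_image]
  · rintro g ⟨_, ⟨_, ⟨q, hq, rfl⟩, rfl⟩, hgq⟩
    have hgq' : sheetTranslate g q ∈ T := preimage_image.subset hgq
    simpa [sheetTranslate] using sheet_eq _ hgq' _ hq rfl

/-- The part of the sheet `w` in the strip around the arc of the letter `l`. -/
def letterStrip (w : FreeGroup (ArcPair τ)) (l : ArcPair τ × Bool) : Set (Sheets τ) :=
  {p | p.1 = w ∧ p.2 ∈ arcStrip (letterArc l)}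

lemma isOpen_letterStrip (w : FreeGroup (ArcPair τ)) (l : ArcPair τ × Bool) :
    IsOpen (letterStrip w l) :=
  isOpen_sigma_iff.2 fun w' => (isOpen_const (p := w' = w)).inter (isOpen_arcStrip _)

lemma sheetGluing.mem_letterStrip (hτ : Function.Involutive τ) {w : FreeGroup (ArcPair τ)}
    {l : ArcPair τ × Bool} {p q : Sheets τ} (h : sheetGluing p q) (hp : p ∈ letterStrip w l) :
    q ∈ letterStrip (letterElt l * w) (letterInv l) := by
  obtain ⟨l', s, hp', hq, hpq⟩ := h
  obtain ⟨rfl, hpl⟩ := hp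
  obtain rfl : l' = l := letterArc_injective hτ
    (eq_of_mem_arcStrip (arcPoint_mem_arcStrip _ s) (hp' ▸ hpl))
  exact ⟨hpq, hq ▸ arcPoint_mem_arcStrip _ _⟩

lemma treeCover_exists_nhds_arcPoint (hτ : Function.Involutive τ) (hτ' : ∀ i, τ i ≠ i)
    (w : FreeGroup (ArcPair τ)) (l : ArcPair τ × Bool) (s : I) :
    ∃ U ∈ 𝓝 (Quot.mk _ ⟨w, arcPoint (letterArc l) s⟩ : TreeCover τ),
      ∀ g : FreeGroup (ArcPair τ), ((g • ·) '' U ∩ U).Nonempty → g = 1 := by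
  refine treeCover_exists_nhds_of_saturated hτ
    ((isOpen_letterStrip w l).union (isOpen_letterStrip (letterElt l * w) (letterInv l))) ?_ ?_
    (Or.inl ⟨rfl, arcPoint_mem_arcStrip _ _⟩)
  · rintro p q h (hp | hp)
    · exact Or.inr (h.mem_letterStrip hτ hp)
    · exact Or.inl (by simpa [letterElt_letterInv] using h.mem_letterStrip hτ hp)
  · have arcs_ne : letterArc l ≠ letterArc (letterInv l) := by
      rw [letterArc_letterInv hτ]
      exact (hτ' _).symm
    rintro p (⟨hp, hpl⟩ | ⟨hp, hpl⟩) q (⟨hq, hql⟩ | ⟨hq, hql⟩) hpq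
    · exact hp.trans hq.symm
    · exact absurd (eq_of_mem_arcStrip (hpq ▸ hpl) hql) arcs_ne
    · exact absurd (eq_of_mem_arcStrip hql (hpq ▸ hpl)) arcs_ne
    · exact hp.trans hq.symm

lemma treeCover_exists_nhds_of_notMem (hτ : Function.Involutive τ) (w : FreeGroup (ArcPair τ))
    {a : discWithArcs m} (ha : a ∉ ⋃ i : Fin m, range (arcPoint i)) :
    ∃ U ∈ 𝓝 (Quot.mk _ ⟨w, a⟩ : TreeCover τ),
      ∀ g : FreeGroup (ArcPair τ), ((g • ·) '' U ∩ U).Nonempty → g = 1 := by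
  have isClosed_arcs : IsClosed (⋃ i : Fin m, range (arcPoint i)) :=
    isClosed_iUnion_of_finite fun i => (isCompact_range (continuous_arcPoint i)).isClosed
  refine treeCover_exists_nhds_of_saturated hτ
    (T := {p | p.1 = w ∧ p.2 ∈ (⋃ i : Fin m, range (arcPoint i))ᶜ}) ?_ ?_ ?_ ⟨rfl, ha⟩
  · exact isOpen_sigma_iff.2 fun w' =>
      (isOpen_const (p := w' = w)).inter isClosed_arcs.isOpen_compl
  · rintro p q ⟨l, s, hp, -, -⟩ ⟨-, not_mem⟩
    exact absurd (mem_iUnion.2 ⟨letterArc l, mem_range.2 ⟨s, hp.symm⟩⟩) not_mem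
  · exact fun p hp q hq _ => hp.1.trans hq.1.symm

lemma isQuotientCoveringMap_treeProj (hτ : Function.Involutive τ) (hτ' : ∀ i, τ i ≠ i) :
    IsQuotientCoveringMap (treeProj hτ) (FreeGroup (ArcPair τ)) where
  toIsQuotientMap := isQuotientMap_treeProj hτ
  continuous_const_smul := continuous_const_smul
  apply_eq_iff_mem_orbit := treeProj_eq_iff hτ hτ'
  disjoint := by
    rintro ⟨⟨w, a⟩⟩
    by_cases ha : a ∈ ⋃ i : Fin m, range (arcPoint i)
    · obtain ⟨i, s, rfl⟩ := mem_iUnion.1 ha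
      obtain ⟨l, rfl⟩ := letterArc_surjective hτ hτ' i
      exact treeCover_exists_nhds_arcPoint hτ hτ' w l s
    · exact treeCover_exists_nhds_of_notMem hτ w ha

end TreeCover

section Contraction

variable {m : ℕ}

lemma convex_discWithArcs : Convex ℝ (discWithArcs m) :=
  (convex_Icc _ _).prod (convex_Icc _ _)

/-- The point dividing the segment from `a` to `b` in the ratio `s : 1 - s`. -/
def discSegment (a b : discWithArcs m) (s : I) : discWithArcs m :=
  ⟨AffineMap.lineMap (a : ℝ × ℝ) b (s : ℝ), convex_discWithArcs.lineMap_mem a.2 b.2 s.2⟩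

lemma continuous_discSegment {X : Type*} [TopologicalSpace X] {f g : X → discWithArcs m}
    {c : X → I} (hf : Continuous f) (hg : Continuous g) (hc : Continuous c) :
    Continuous fun x => discSegment (f x) (g x) (c x) := by
  unfold discSegment
  simp only [AffineMap.lineMap_apply_module]
  fun_prop

@[simp] lemma discSegment_zero (a b : discWithArcs m) : discSegment a b 0 = a :=
  Subtype.ext (AffineMap.lineMap_apply_zero _ _)

@[simp] lemma discSegment_one (a b : discWithArcs m) : discSegment a b 1 = b :=
  Subtype.ext (AffineMap.lineMap_apply_one _ _)

@[simp] lemma discSegment_self (a : discWithArcs m) (s : I) : discSegment a a s = a :=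
  Subtype.ext (AffineMap.lineMap_same_apply _ _)

/-- The parameter of the projection of a point to the `i`-th arc. -/
def arcCoord (i : Fin m) (a : discWithArcs m) : I :=
  projIcc 0 1 zero_le_one (a.1.1 - (2 * ((i : ℕ) : ℝ) + 1))

lemma continuous_arcCoord (i : Fin m) : Continuous (arcCoord i) := by
  unfold arcCoord
  exact continuous_projIcc.comp (by fun_prop)

@[simp] lemma arcCoord_arcPoint (i : Fin m) (s : I) : arcCoord i (arcPoint i s) = s := by
  simp [arcCoord, arcPoint_fst]

variable {τ : Fin m → Fin m}

/-- A function of time which is `0` until `1 / (n + 2)` and `1` from `1 / (n + 1)` on. -/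
def stageTime (n : ℕ) (s : I) : I :=
  projIcc 0 1 zero_le_one (((n : ℝ) + 1) * (n + 2) * s - (n + 1))

lemma continuous_stageTime (n : ℕ) : Continuous (stageTime n) := by
  unfold stageTime
  exact continuous_projIcc.comp (by fun_prop)

lemma stageTime_eq_zero {n : ℕ} {s : I} (h : ((n : ℝ) + 2) * s ≤ 1) : stageTime n s = 0 :=
  projIcc_of_le_left _ (by nlinarith [n.cast_nonneg (α := ℝ)])

lemma stageTime_eq_one {n : ℕ} {s : I} (h : 1 ≤ ((n : ℝ) + 1) * s) : stageTime n s = 1 :=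
  projIcc_of_right_le _ (by nlinarith [n.cast_nonneg (α := ℝ)])

/-- The contraction of the tree of discs: the discs at distance `n` from the root are collapsed
during the time interval `[1 / (n + 2), 1 / (n + 1)]` to the arc towards the root. -/
def treeContraction (a₀ : discWithArcs m) :
    List (ArcPair τ × Bool) → discWithArcs m × I → TreeCover τ
  | [], p => Quot.mk _ ⟨1, discSegment p.1 a₀ (stageTime 0 p.2)⟩
  | l :: L, p =>
    if (((l :: L).length : ℝ) + 1) * p.2 ≤ 1 then
      Quot.mk _ ⟨FreeGroup.mk (l :: L), discSegment p.1
        (arcPoint (letterArc (letterInv l)) (arcCoord (letterArc (letterInv l)) p.1))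
        (stageTime (l :: L).length p.2)⟩
    else treeContraction a₀ L
      (arcPoint (letterArc l) (σ (arcCoord (letterArc (letterInv l)) p.1)), p.2)

variable (a₀ : discWithArcs m)

lemma treeContraction_of_le (L : List (ArcPair τ × Bool)) (a : discWithArcs m) {s : I}
    (h : ((L.length : ℝ) + 2) * s ≤ 1) :
    treeContraction a₀ L (a, s) = Quot.mk _ ⟨FreeGroup.mk L, a⟩ := by
  cases L with
  | nil =>
    rw [treeContraction, stageTime_eq_zero (by simpa using h), discSegment_zero]
    rfl
  | cons l L =>
    have hs := s.2.1
    rw [treeContraction, if_pos (by dsimp only; nlinarith), stageTime_eq_zero h, discSegment_zero]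

lemma treeCover_mk_cons (l : ArcPair τ × Bool) (L : List (ArcPair τ × Bool)) (s : I) :
    (Quot.mk _ ⟨FreeGroup.mk (l :: L), arcPoint (letterArc (letterInv l)) s⟩ : TreeCover τ) =
      Quot.mk _ ⟨FreeGroup.mk L, arcPoint (letterArc l) (σ s)⟩ :=
  (Quot.sound ⟨l, σ s, rfl, by simp, (letterElt_mul_mk l L).symm⟩).symm

lemma continuous_treeCover_mk (w : FreeGroup (ArcPair τ)) :
    Continuous fun a : discWithArcs m => (Quot.mk _ ⟨w, a⟩ : TreeCover τ) :=
  continuous_quot_mk.comp (continuous_sheetMk w)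

lemma continuous_treeContraction (L : List (ArcPair τ × Bool)) :
    Continuous (treeContraction a₀ L) := by
  induction L with
  | nil =>
    simp only [treeContraction]
    exact (continuous_treeCover_mk 1).comp (continuous_discSegment continuous_fst continuous_const
      ((continuous_stageTime 0).comp continuous_snd))
  | cons l L ih =>
    simp only [treeContraction]
    have continuous_exit : Continuous fun p : discWithArcs m × I =>
        arcCoord (letterArc (letterInv l)) p.1 := (continuous_arcCoord _).comp continuous_fst
    refine Continuous.if_le ?_ ?_ (by fun_prop) continuous_const ?_
    · exact (continuous_treeCover_mk _).comp (continuous_discSegment continuous_fst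
        ((continuous_arcPoint _).comp continuous_exit)
        ((continuous_stageTime _).comp continuous_snd))
    · exact ih.comp (((continuous_arcPoint _).comp
        (unitInterval.continuous_symm.comp continuous_exit)).prodMk continuous_snd)
    · rintro ⟨a, s⟩ h
      dsimp only at h ⊢
      rw [stageTime_eq_one h.ge, discSegment_one, treeCover_mk_cons, treeContraction_of_le]
      rw [List.length_cons, Nat.cast_succ] at h
      linarith

lemma treeContraction_cons_arcPoint (l : ArcPair τ × Bool) (L : List (ArcPair τ × Bool))
    (t s : I) :
    treeContraction a₀ (l :: L) (arcPoint (letterArc (letterInv l)) t, s) =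
      treeContraction a₀ L (arcPoint (letterArc l) (σ t), s) := by
  rw [treeContraction]
  simp only [arcCoord_arcPoint, discSegment_self]
  split_ifs with h
  · rw [treeCover_mk_cons, treeContraction_of_le]
    rw [List.length_cons, Nat.cast_succ] at h
    linarith
  · rfl

lemma treeContraction_one (L : List (ArcPair τ × Bool)) (a : discWithArcs m) :
    treeContraction a₀ L (a, 1) = Quot.mk _ ⟨1, a₀⟩ := by
  induction L generalizing a with
  | nil => rw [treeContraction, stageTime_eq_one (by simp), discSegment_one]
  | cons l L ih =>
    rw [treeContraction, if_neg, ih]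
    simp only [List.length_cons, Icc.coe_one]
    push_cast
    linarith [L.length.cast_nonneg (α := ℝ)]

lemma toWord_letterElt_mul (l : ArcPair τ × Bool) (w : FreeGroup (ArcPair τ)) :
    (letterElt l * w).toWord = l :: w.toWord ∨
      w.toWord = letterInv l :: (letterElt l * w).toWord := by
  have toWord_eq_reduce : (letterElt l * w).toWord = FreeGroup.reduce (l :: w.toWord) := by
    rw [← FreeGroup.toWord_mk, ← letterElt_mul_mk, FreeGroup.mk_toWord]
  rw [toWord_eq_reduce, FreeGroup.reduce.cons, FreeGroup.reduce_toWord]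
  rcases w.toWord with _ | ⟨l', L⟩
  · exact Or.inl rfl
  · dsimp only
    split_ifs with cancel
    · have l'_eq : l' = letterInv l :=
        Prod.ext cancel.1.symm (Bool.eq_not_of_ne fun h => by simp [h] at cancel)
      exact Or.inr (congrArg (· :: L) l'_eq)
    · exact Or.inl rfl

lemma treeContraction_eq_of_sheetGluing {p q : Sheets τ} (h : sheetGluing p q) (s : I) :
    treeContraction a₀ p.1.toWord (p.2, s) = treeContraction a₀ q.1.toWord (q.2, s) := by
  obtain ⟨w, a⟩ := p
  obtain ⟨w', a'⟩ := q
  obtain ⟨l, t, rfl, rfl, rfl⟩ := h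
  dsimp only
  rcases toWord_letterElt_mul l w with h | h
  · rw [h, treeContraction_cons_arcPoint, unitInterval.symm_symm]
  · simpa only [← h, letterInv_letterInv] using
      treeContraction_cons_arcPoint a₀ (letterInv l) (letterElt l * w).toWord t s

theorem contractibleSpace_treeCover (τ : Fin m → Fin m) : ContractibleSpace (TreeCover τ) := by
  let a₀ : discWithArcs m :=
    ⟨(0, 0), left_mem_Icc.2 (by positivity), left_mem_Icc.2 zero_le_one⟩
  let sheetTrack (p : Sheets τ) : C(I, TreeCover τ) :=
    ⟨fun s => treeContraction a₀ p.1.toWord (p.2, s),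
      (continuous_treeContraction a₀ _).comp (by fun_prop)⟩
  have continuous_sheetTrack : Continuous sheetTrack := continuous_sigma fun w =>
    (ContinuousMap.curry ⟨_, continuous_treeContraction a₀ w.toWord⟩).continuous
  let track : C(TreeCover τ, C(I, TreeCover τ)) :=
    ⟨Quot.lift sheetTrack fun p q h => ContinuousMap.ext (treeContraction_eq_of_sheetGluing a₀ h),
      isQuotientMap_quot_mk.continuous_iff.2 continuous_sheetTrack⟩
  refine (contractible_iff_id_nullhomotopic _).2 ⟨Quot.mk _ ⟨1, a₀⟩, ⟨⟨⟨fun p => track p.2 p.1,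
    (ContinuousMap.continuous_uncurry_of_continuous track).comp continuous_swap⟩, ?_, ?_⟩⟩⟩
  · rintro ⟨⟨w, a⟩⟩
    change treeContraction a₀ w.toWord (a, 0) = _
    rw [treeContraction_of_le _ _ _ (by simp), FreeGroup.mk_toWord]
    rfl
  · rintro ⟨⟨w, a⟩⟩
    exact treeContraction_one a₀ _ _

end Contraction

theorem IsPuncturedSurface.exists_contractible_covering {S : Type*} [TopologicalSpace S]
    (hS : IsPuncturedSurface S) :
    CompactSpace S ∧ T2Space S ∧ ∃ (G : Type) (_ : Group G) (E : Type) (_ : TopologicalSpace E)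
      (_ : MulAction G E) (p : E → S), ContractibleSpace E ∧ IsQuotientCoveringMap p G := by
  obtain ⟨m, τ, hτ, hτ', ⟨f⟩⟩ := hS
  have := gluedDisc_t2Space hτ
  exact ⟨f.symm.compactSpace, f.symm.t2Space, FreeGroup (ArcPair τ), inferInstance, TreeCover τ,
    inferInstance, inferInstance, f.symm ∘ treeProj hτ, contractibleSpace_treeCover τ,
    (isQuotientCoveringMap_treeProj hτ hτ').homeomorph_comp f.symm⟩

/-! ## Foliations given by a developing map -/

section DeckGroup

variable {N E : Type*} [TopologicalSpace E]

/-- The group of those deck transformations of `Q : E × ℝ → N` that are products of a homeomorphism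
of `E` and a homeomorphism of `ℝ`, so that they preserve the foliation of `E × ℝ` by the
slices `E × {t}`. -/
def deckGroup (Q : E × ℝ → N) : Subgroup ((E ≃ₜ E) × (ℝ ≃ₜ ℝ)) where
  carrier := {d | ∀ e t, Q (d.1 e, d.2 t) = Q (e, t)}
  one_mem' _ _ := rfl
  mul_mem' {d d'} hd hd' e t := (hd (d'.1 e) (d'.2 t)).trans (hd' e t)
  inv_mem' {d} hd e t := by simpa using (hd (d⁻¹.1 e) (d⁻¹.2 t)).symm

/-- The deck transformations that preserve the slice `E × {t}`; it is the deck group of the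
parametrization `e ↦ Q (e, t)` of a leaf. -/
def leafGroup (Q : E × ℝ → N) (t : ℝ) : Subgroup ((E ≃ₜ E) × (ℝ ≃ₜ ℝ)) where
  carrier := {d | d ∈ deckGroup Q ∧ d.2 t = t}
  one_mem' := ⟨one_mem _, rfl⟩
  mul_mem' {d _} hd hd' := ⟨mul_mem hd.1 hd'.1, (congrArg d.2 hd'.2).trans hd.2⟩
  inv_mem' {d} hd := ⟨inv_mem hd.1, d.2.symm_apply_eq.2 hd.2.symm⟩

instance (Q : E × ℝ → N) (t : ℝ) : MulAction (leafGroup Q t) E where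
  smul d e := d.1.1 e
  one_smul _ := rfl
  mul_smul _ _ _ := rfl

lemma leafGroup_apply_smul {Q : E × ℝ → N} {t : ℝ} (d : leafGroup Q t) (e : E) :
    Q (d • e, t) = Q (e, t) := by
  have map_deck := d.2.1 e t
  rwa [d.2.2] at map_deck

end DeckGroup

/-- `Q : E × ℝ → N` is a surjective local homeomorphism whose fibres are the orbits of a group of
deck transformations preserving the product foliation, so that the latter descends to `N`. -/
structure IsFoliatedCover {N E : Type*} [TopologicalSpace N] [TopologicalSpace E]
    (Q : E × ℝ → N) : Prop where
  surjective : Function.Surjective Q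
  isLocalHomeomorph : IsLocalHomeomorph Q
  exists_deck : ∀ {e e' t t'}, Q (e, t) = Q (e', t') → ∃ d ∈ deckGroup Q, d.1 e = e' ∧ d.2 t = t'

/-- A chart of the foliation with developing map `Q`, made from a local inverse of `Q` and a
chart of `E`. -/
def foliatedChart {N E : Type*} [TopologicalSpace N] [TopologicalSpace E]
    (Φ : OpenPartialHomeomorph (E × ℝ) N) (C : OpenPartialHomeomorph E (EuclideanHalfSpace 2)) :
    OpenPartialHomeomorph N HalfSpaceProd :=
  Φ.symm.trans (C.prod (OpenPartialHomeomorph.refl ℝ))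

section FoliatedChart

variable {N E : Type*} [TopologicalSpace N] [TopologicalSpace E] {Q : E × ℝ → N}
  {Φ : OpenPartialHomeomorph (E × ℝ) N} {C : OpenPartialHomeomorph E (EuclideanHalfSpace 2)}

lemma foliatedChart_apply (hΦ : EqOn Φ Q Φ.source)
    (C : OpenPartialHomeomorph E (EuclideanHalfSpace 2)) {z : E × ℝ} (hz : z ∈ Φ.source) :
    foliatedChart Φ C (Q z) = (C z.1, z.2) := by
  rw [← hΦ hz]
  change (C (Φ.symm (Φ z)).1, (Φ.symm (Φ z)).2) = _
  rw [Φ.left_inv hz]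

lemma mem_foliatedChart_source (hΦ : EqOn Φ Q Φ.source) {y : N} :
    y ∈ (foliatedChart Φ C).source ↔ ∃ z ∈ Φ.source, z.1 ∈ C.source ∧ Q z = y := by
  simp only [foliatedChart, OpenPartialHomeomorph.trans_source,
    OpenPartialHomeomorph.symm_source, OpenPartialHomeomorph.prod_source,
    OpenPartialHomeomorph.refl_source, mem_inter_iff, mem_preimage, mem_prod, mem_univ, and_true]
  constructor
  · rintro ⟨hy, hyC⟩
    exact ⟨Φ.symm y, Φ.map_target hy, hyC,
      (hΦ (Φ.map_target hy)).symm.trans (Φ.right_inv hy)⟩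
  · rintro ⟨z, hz, hzC, rfl⟩
    rw [← hΦ hz, Φ.left_inv hz]
    exact ⟨Φ.map_source hz, hzC⟩

lemma foliatedChart_symm_apply (hΦ : EqOn Φ Q Φ.source) {e : E} (he : e ∈ C.source) {t : ℝ}
    (ht : (C e, t) ∈ (foliatedChart Φ C).target) :
    (foliatedChart Φ C).symm (C e, t) = Q (e, t) := by
  have mem_source : (C.symm (C e), t) ∈ Φ.source := ht.2
  rw [C.left_inv he] at mem_source
  rw [← hΦ mem_source]
  change Φ (C.symm (C e), t) = _
  rw [C.left_inv he]

end FoliatedChart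

lemma SurfaceFoliation.isOpen_plaque {N : Type*} [TopologicalSpace N] (F : SurfaceFoliation N)
    {e : OpenPartialHomeomorph N HalfSpaceProd} (he : e ∈ F.charts) (t : ℝ) {V : Set N}
    (hV : IsOpen V) :
    IsOpen (X := F.LeafSpace) {y : N | y ∈ e.source ∧ (e y).2 = t ∧ y ∈ V} :=
  TopologicalSpace.isOpen_generateFrom_of_mem ⟨e, he, t, V, hV, rfl⟩

namespace IsFoliatedCover

variable {N E : Type*} [TopologicalSpace N] [TopologicalSpace E] {Q : E × ℝ → N}
  {𝒞 : Set (OpenPartialHomeomorph E (EuclideanHalfSpace 2))}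

lemma continuous (hQ : IsFoliatedCover Q) : Continuous Q := hQ.isLocalHomeomorph.continuous

/-- The foliated charts made from arbitrary local inverses of `Q` and the charts `C ∈ 𝒞`. -/
def chartSet (Q : E × ℝ → N) (𝒞 : Set (OpenPartialHomeomorph E (EuclideanHalfSpace 2))) :
    Set (OpenPartialHomeomorph N HalfSpaceProd) :=
  {ch | ∃ Φ : OpenPartialHomeomorph (E × ℝ) N, EqOn Φ Q Φ.source ∧ ∃ C ∈ 𝒞,
    ch = foliatedChart Φ C}

lemma exists_chart (hQ : IsFoliatedCover Q) (h𝒞 : ∀ e, ∃ C ∈ 𝒞, e ∈ C.source) (e : E) (t : ℝ) :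
    ∃ (Φ : OpenPartialHomeomorph (E × ℝ) N) (C : OpenPartialHomeomorph E (EuclideanHalfSpace 2)),
      EqOn Φ Q Φ.source ∧ C ∈ 𝒞 ∧ (e, t) ∈ Φ.source ∧ e ∈ C.source := by
  obtain ⟨Φ, hΦ, rfl⟩ := hQ.isLocalHomeomorph (e, t)
  obtain ⟨C, hC, heC⟩ := h𝒞 e
  exact ⟨Φ, C, fun _ _ => rfl, hC, hΦ, heC⟩

lemma exists_deck_mem_source (hQ : IsFoliatedCover Q) {Φ : OpenPartialHomeomorph (E × ℝ) N}
    {C : OpenPartialHomeomorph E (EuclideanHalfSpace 2)} (hΦ : EqOn Φ Q Φ.source) {e : E} {t : ℝ}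
    (h : Q (e, t) ∈ (foliatedChart Φ C).source) :
    ∃ d ∈ deckGroup Q, (d.1 e, d.2 t) ∈ Φ.source ∧ d.1 e ∈ C.source := by
  obtain ⟨⟨e', t'⟩, hΦ', hC', h⟩ := (mem_foliatedChart_source hΦ).1 h
  obtain ⟨d, hd, rfl, rfl⟩ := hQ.exists_deck h.symm
  exact ⟨d, hd, hΦ', hC'⟩

/-- The foliation of `N` whose lift to `E × ℝ` is the product foliation. -/
def foliation (hQ : IsFoliatedCover Q) (h𝒞 : ∀ e, ∃ C ∈ 𝒞, e ∈ C.source) :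
    SurfaceFoliation N where
  charts := chartSet Q 𝒞
  cover x := by
    obtain ⟨⟨e, t⟩, rfl⟩ := hQ.surjective x
    obtain ⟨Φ, C, hΦ, hC, heΦ, heC⟩ := hQ.exists_chart h𝒞 e t
    exact ⟨_, ⟨Φ, hΦ, C, hC, rfl⟩, (mem_foliatedChart_source hΦ).2 ⟨_, heΦ, heC, rfl⟩⟩
  compatible := by
    rintro _ ⟨Φ, hΦ, C, -, rfl⟩ _ ⟨Φ', hΦ', C', -, rfl⟩ x ⟨hx, hx'⟩
    obtain ⟨⟨e, t⟩, hz, -, rfl⟩ := (mem_foliatedChart_source hΦ).1 hx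
    obtain ⟨d, hd, hz', -⟩ := hQ.exists_deck_mem_source hΦ' hx'
    refine ⟨d.2, ?_⟩
    have continuous_deck : Continuous fun z : E × ℝ => (d.1 z.1, d.2 z.2) := by fun_prop
    have near : {z : E × ℝ | z ∈ Φ.source ∧ (d.1 z.1, d.2 z.2) ∈ Φ'.source} ∈ 𝓝 (e, t) :=
      Filter.inter_mem (Φ.open_source.mem_nhds hz)
        ((Φ'.open_source.preimage continuous_deck).mem_nhds hz')
    filter_upwards [hQ.isLocalHomeomorph.isOpenMap.image_mem_nhds near]
    rintro _ ⟨⟨a, s⟩, ⟨ha, ha'⟩, rfl⟩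
    rw [foliatedChart_apply hΦ C ha, ← hd a s, foliatedChart_apply hΦ' C' ha']

variable (hQ : IsFoliatedCover Q) (h𝒞 : ∀ e, ∃ C ∈ 𝒞, e ∈ C.source)

/-- The parametrization of a leaf by the slice `E × {t}`. -/
def toLeafSpace (t : ℝ) (e : E) : (hQ.foliation h𝒞).LeafSpace := Q (e, t)

lemma continuous_toLeafSpace (t : ℝ) : Continuous (hQ.toLeafSpace h𝒞 t) := by
  refine continuous_generateFrom_iff.2 ?_
  rintro _ ⟨_, ⟨Φ, hΦ, C, -, rfl⟩, t', V, hV, rfl⟩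
  rw [isOpen_iff_mem_nhds]
  rintro e ⟨he, ht', heV⟩
  obtain ⟨d, hd, hdΦ, -⟩ := hQ.exists_deck_mem_source hΦ he
  have continuous_slice : Continuous fun a : E => Q (a, t) := hQ.continuous.comp (by fun_prop)
  have height {a : E} (ha : (d.1 a, d.2 t) ∈ Φ.source) :
      (foliatedChart Φ C (Q (a, t))).2 = d.2 t := by
    rw [← hd a t, foliatedChart_apply hΦ C ha]
  have continuous_deck : Continuous fun a : E => (d.1 a, d.2 t) := by fun_prop
  filter_upwards [
    continuous_slice.continuousAt.preimage_mem_nhds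
      ((foliatedChart Φ C).open_source.mem_nhds he),
    continuous_deck.continuousAt.preimage_mem_nhds (Φ.open_source.mem_nhds hdΦ),
    continuous_slice.continuousAt.preimage_mem_nhds (hV.mem_nhds heV)] with a ha haΦ haV
  exact ⟨ha, (height haΦ).trans ((height hdΦ).symm.trans ht'), haV⟩

lemma isOpenMap_toLeafSpace (t : ℝ) : IsOpenMap (hQ.toLeafSpace h𝒞 t) := by
  intro B hB
  rw [isOpen_iff_mem_nhds]
  rintro _ ⟨e, he, rfl⟩
  obtain ⟨Φ, C, hΦ, hC, heΦ, heC⟩ := hQ.exists_chart h𝒞 e t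
  have isOpen_image : IsOpen (Q '' (Φ.source ∩ (B ×ˢ univ))) :=
    hQ.isLocalHomeomorph.isOpenMap _ (Φ.open_source.inter (hB.prod isOpen_univ))
  refine mem_nhds_iff.2 ⟨_, ?_,
    (hQ.foliation h𝒞).isOpen_plaque ⟨Φ, hΦ, C, hC, rfl⟩ t isOpen_image, ?_⟩
  · rintro _ ⟨-, ht, ⟨⟨a, s⟩, ⟨haΦ, haB⟩, rfl⟩⟩
    obtain rfl : s = t := by simpa only [foliatedChart_apply hΦ C haΦ] using ht
    exact ⟨a, haB.1, rfl⟩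
  · exact ⟨(mem_foliatedChart_source hΦ).2 ⟨_, heΦ, heC, rfl⟩,
      congrArg Prod.snd (foliatedChart_apply hΦ C heΦ), (e, t), ⟨heΦ, he, mem_univ _⟩, rfl⟩

lemma isLeafwise (t : ℝ) {a : I → E} (ha : Continuous a) :
    (hQ.foliation h𝒞).IsLeafwise fun s => Q (a s, t) :=
  (hQ.continuous_toLeafSpace h𝒞 t).comp ha

lemma range_toLeafSpace_subset {e e' : E} {t t' : ℝ} (h : Q (e, t) = Q (e', t')) :
    range (hQ.toLeafSpace h𝒞 t) ⊆ range (hQ.toLeafSpace h𝒞 t') := by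
  obtain ⟨d, hd, -, rfl⟩ := hQ.exists_deck h
  rintro _ ⟨a, rfl⟩
  exact ⟨d.1 a, hd a t⟩

lemma isClopen_range_toLeafSpace (t : ℝ) : IsClopen (range (hQ.toLeafSpace h𝒞 t)) := by
  refine ⟨isOpen_compl_iff.1 (isOpen_iff_mem_nhds.2 fun y hy => ?_),
    (hQ.isOpenMap_toLeafSpace h𝒞 t).isOpen_range⟩
  obtain ⟨⟨e', t'⟩, rfl⟩ := hQ.surjective y
  refine mem_of_superset ((hQ.isOpenMap_toLeafSpace h𝒞 t').isOpen_range.mem_nhds ⟨e', rfl⟩) ?_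
  rintro _ ⟨a, rfl⟩ ⟨b, hb⟩
  exact hy (hQ.range_toLeafSpace_subset h𝒞 (e := a) (e' := b) hb.symm ⟨e', rfl⟩)

lemma isLeafwise_mem_range {c : I → N} (hc : (hQ.foliation h𝒞).IsLeafwise c) {b : E} {t : ℝ}
    (h₀ : c 0 = Q (b, t)) (s : I) : c s ∈ range (hQ.toLeafSpace h𝒞 t) :=
  (isPreconnected_range hc).subset_isClopen (hQ.isClopen_range_toLeafSpace h𝒞 t)
    ⟨c 0, mem_range_self _, b, h₀.symm⟩ (mem_range_self s)

lemma leaf_eq_range [PathConnectedSpace E] (e : E) (t : ℝ) :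
    (hQ.foliation h𝒞).leaf (Q (e, t)) = range (hQ.toLeafSpace h𝒞 t) := by
  refine Subset.antisymm ?_ ?_
  · rintro y ⟨γ⟩
    have := hQ.isLeafwise_mem_range h𝒞 γ.continuous (b := e) (t := t) γ.source 1
    rwa [γ.target] at this
  · rintro _ ⟨a, rfl⟩
    exact ⟨(PathConnectedSpace.somePath e a).map (hQ.continuous_toLeafSpace h𝒞 t)⟩

lemma height_eq_of_isLeafwise {a : I → E} {w : I → ℝ} (ha : Continuous a) (hw : Continuous w)
    (leafwise : (hQ.foliation h𝒞).IsLeafwise fun s => Q (a s, w s)) (s s' : I) : w s = w s' := by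
  suffices locally_constant : IsLocallyConstant w from
    locally_constant.apply_eq_of_isPreconnected isPreconnected_univ (mem_univ s) (mem_univ s')
  rw [IsLocallyConstant.iff_eventually_eq]
  intro s
  obtain ⟨Φ, C, hΦ, hC, hsΦ, hsC⟩ := hQ.exists_chart h𝒞 (a s) (w s)
  have plaque := (((hQ.foliation h𝒞).isOpen_plaque ⟨Φ, hΦ, C, hC, rfl⟩ (w s)
    isOpen_univ).preimage leafwise).mem_nhds (x := s)
      ⟨(mem_foliatedChart_source hΦ).2 ⟨_, hsΦ, hsC, rfl⟩,
        congrArg Prod.snd (foliatedChart_apply hΦ C hsΦ), mem_univ _⟩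
  filter_upwards [plaque,
    (ha.prodMk hw).continuousAt.preimage_mem_nhds (Φ.open_source.mem_nhds hsΦ)] with r hr hrΦ
  simpa only [foliatedChart_apply hΦ C hrΦ] using hr.2.1

end IsFoliatedCover

/-! ## Holonomy covers of the leaves -/

/-- The deck group of `Q` acts faithfully by germs of homeomorphisms of the transversal `ℝ`. -/
def HasFaithfulHolonomy {N E : Type*} [TopologicalSpace E] (Q : E × ℝ → N) : Prop :=
  ∀ d ∈ deckGroup Q, ∀ t, (∀ᶠ s in 𝓝 t, d.2 s = s) → d = 1

namespace IsFoliatedCover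

variable {N E : Type*} [TopologicalSpace N] [TopologicalSpace E] {Q : E × ℝ → N}
  {𝒞 : Set (OpenPartialHomeomorph E (EuclideanHalfSpace 2))}

lemma deck_eq_one [T2Space E] [PreconnectedSpace E] (hQ : IsFoliatedCover Q)
    {d : (E ≃ₜ E) × (ℝ ≃ₜ ℝ)} (hd : d ∈ deckGroup Q) {e : E} {t : ℝ} (he : d.1 e = e)
    (ht : d.2 t = t) : d = 1 := by
  have deck_eq_id : (fun z : E × ℝ => (d.1 z.1, d.2 z.2)) = id :=
    (T2Space.isSeparatedMap Q).eq_of_comp_eq hQ.isLocalHomeomorph.isLocallyInjective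
      (by fun_prop) continuous_id (funext fun z => hd z.1 z.2) (e, t) (Prod.ext he ht)
  exact Prod.ext (Homeomorph.ext fun a => congrArg Prod.fst (congrFun deck_eq_id (a, t)))
    (Homeomorph.ext fun s => congrArg Prod.snd (congrFun deck_eq_id (e, s)))

lemma exists_injOn_nhds (hQ : IsFoliatedCover Q) (z : E × ℝ) : ∃ V ∈ 𝓝 z, InjOn Q V :=
  isLocallyInjective_iff_nhds.1 hQ.isLocalHomeomorph.isLocallyInjective z

variable (hQ : IsFoliatedCover Q) (h𝒞 : ∀ e, ∃ C ∈ 𝒞, e ∈ C.source)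

/-- The parametrization of the leaf through `Q (e₀, t)` by the slice `E × {t}`. -/
def leafProj [PathConnectedSpace E] (e₀ : E) (t : ℝ) (e : E) :
    (hQ.foliation h𝒞).leaf (Q (e₀, t)) :=
  ⟨hQ.toLeafSpace h𝒞 t e, (hQ.leaf_eq_range h𝒞 e₀ t).ge (mem_range_self e)⟩

lemma isOpenQuotientMap_leafProj [PathConnectedSpace E] (e₀ : E) (t : ℝ) :
    IsOpenQuotientMap (hQ.leafProj h𝒞 e₀ t) where
  surjective := by
    rintro ⟨y, hy⟩
    obtain ⟨e, rfl⟩ := (hQ.leaf_eq_range h𝒞 e₀ t).le hy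
    exact ⟨e, rfl⟩
  continuous := (hQ.continuous_toLeafSpace h𝒞 t).subtype_mk _
  isOpenMap B hB := by
    convert (hQ.isOpenMap_toLeafSpace h𝒞 t B hB).preimage continuous_subtype_val using 1
    ext y
    exact exists_congr fun b => and_congr_right fun _ => Subtype.ext_iff

lemma isQuotientCoveringMap_leafProj [PathConnectedSpace E] [T2Space E] (e₀ : E) (t : ℝ) :
    IsQuotientCoveringMap (hQ.leafProj h𝒞 e₀ t) (leafGroup Q t) where
  toIsQuotientMap := (hQ.isOpenQuotientMap_leafProj h𝒞 e₀ t).isQuotientMap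
  continuous_const_smul d := d.1.1.continuous
  apply_eq_iff_mem_orbit {e₁ e₂} := by
    constructor
    · intro he
      obtain ⟨d, hd, hde, hdt⟩ := hQ.exists_deck (congrArg Subtype.val he).symm
      exact ⟨⟨d, hd, hdt⟩, hde⟩
    · rintro ⟨d, rfl⟩
      exact Subtype.ext (leafGroup_apply_smul d e₂)
  disjoint e := by
    obtain ⟨V, hV, injective⟩ := hQ.exists_injOn_nhds (e, t)
    refine ⟨(fun a => (a, t)) ⁻¹' V,
      (by fun_prop : Continuous fun a : E => (a, t)).continuousAt.preimage_mem_nhds hV, ?_⟩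
    rintro d ⟨_, ⟨a, ha, rfl⟩, hda⟩
    have fixed : (d • a, t) = (a, t) := injective hda ha (leafGroup_apply_smul d a)
    exact Subtype.ext (hQ.deck_eq_one d.2.1 (congrArg Prod.fst fixed) d.2.2)

section Lifting

variable [PathConnectedSpace E] [T2Space E]

lemma exists_lift_of_isLeafwise {c : I → N} (hc : (hQ.foliation h𝒞).IsLeafwise c) {b : E} {t : ℝ}
    (h₀ : c 0 = Q (b, t)) : ∃ L : C(I, E), L 0 = b ∧ ∀ s, Q (L s, t) = c s := by
  have mem_leaf (s : I) : c s ∈ (hQ.foliation h𝒞).leaf (Q (b, t)) :=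
    (hQ.leaf_eq_range h𝒞 b t).ge (hQ.isLeafwise_mem_range h𝒞 hc h₀ s)
  obtain ⟨L, lift, hL₀⟩ :=
    (hQ.isQuotientCoveringMap_leafProj h𝒞 b t).isCoveringMap.exists_path_lifts
      ⟨fun s => ⟨c s, mem_leaf s⟩, hc.subtype_mk _⟩ b (Subtype.ext h₀)
  exact ⟨L, hL₀, fun s => congrArg Subtype.val (congrFun lift s)⟩

omit [PathConnectedSpace E] in
include hQ in
lemma lift_unique {L L' : C(I, E)} {t : ℝ} (heq : ∀ s, Q (L s, t) = Q (L' s, t))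
    (h₀ : L 0 = L' 0) : L = L' := by
  have lift_eq : (fun s => (L s, t)) = fun s => (L' s, t) :=
    (T2Space.isSeparatedMap Q).eq_of_comp_eq hQ.isLocalHomeomorph.isLocallyInjective
      (by fun_prop) (by fun_prop) (funext heq) 0 (Prod.ext h₀ rfl)
  exact ContinuousMap.ext fun s => congrArg Prod.fst (congrFun lift_eq s)

lemma exists_lift_family {b : E} {B : Set ℝ} {H : I × ℝ → N} (hH : ContinuousOn H (univ ×ˢ B))
    (leafwise : ∀ t ∈ B, (hQ.foliation h𝒞).IsLeafwise fun s => H (s, t))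
    (h₀ : ∀ t ∈ B, H (0, t) = Q (b, t)) :
    ∃ K : C(I × B, E), ∀ t : B, K (0, t) = b ∧ ∀ s, Q (K (s, t), t) = H (s, t) := by
  choose K hK₀ hK using fun t : B =>
    hQ.exists_lift_of_isLeafwise h𝒞 (leafwise t t.2) (h₀ t t.2)
  have continuous_lift : Continuous fun z : I × B => (K z.2 z.1, (z.2 : ℝ)) := by
    refine hQ.isLocalHomeomorph.continuous_lift (T2Space.isSeparatedMap Q)
      ⟨fun z : I × B => H (z.1, z.2),
        hH.comp_continuous (by fun_prop) fun z => ⟨mem_univ _, z.2.2⟩⟩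
      (funext fun z => hK z.2 z.1) ?_
      fun t => (K t).continuous.prodMk (continuous_const (y := (t : ℝ)))
    simp only [hK₀]
    fun_prop
  exact ⟨⟨fun z => K z.2 z.1, continuous_lift.fst⟩, fun t => ⟨hK₀ t, hK t⟩⟩

omit [PathConnectedSpace E] [T2Space E] in
include hQ in
lemma eq_of_continuous_section (faithful : HasFaithfulHolonomy Q) {b : E} {B : Set ℝ} {t : ℝ}
    (hB : B ∈ 𝓝 t) {κ : B → E} (hκ : Continuous κ) (hQκ : ∀ s : B, Q (κ s, s) = Q (b, s)) :
    κ ⟨t, mem_of_mem_nhds hB⟩ = b := by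
  obtain ⟨d, hd, hdb, (hdt : d.2 t = t)⟩ := hQ.exists_deck (hQκ ⟨t, mem_of_mem_nhds hB⟩).symm
  obtain ⟨V, hV, injective⟩ := hQ.exists_injOn_nhds (κ ⟨t, mem_of_mem_nhds hB⟩, t)
  have near_section : ∀ᶠ s : B in 𝓝 (⟨t, mem_of_mem_nhds hB⟩ : B), (κ s, (s : ℝ)) ∈ V :=
    (hκ.prodMk continuous_subtype_val).continuousAt.preimage_mem_nhds hV
  have near_deck : ∀ᶠ s : B in 𝓝 (⟨t, mem_of_mem_nhds hB⟩ : B), (d.1 b, d.2 s) ∈ V := by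
    have continuous_deck : Continuous fun s : B => (d.1 b, d.2 s) := by fun_prop
    refine continuous_deck.continuousAt.preimage_mem_nhds ?_
    change V ∈ 𝓝 (d.1 b, d.2 t)
    rwa [hdb, hdt]
  have fixed : ∀ᶠ s : B in 𝓝 (⟨t, mem_of_mem_nhds hB⟩ : B), d.2 (s : ℝ) = s := by
    filter_upwards [near_section, near_deck] with s hs hds
    exact congrArg Prod.snd (injective hds hs ((hd b s).trans (hQκ s).symm))
  rw [← hdb, faithful d hd t]
  · rfl
  · rwa [← map_nhds_subtype_coe_eq_nhds (mem_of_mem_nhds hB) hB, eventually_map]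

omit [PathConnectedSpace E] [T2Space E] in
lemma hasTrivialHolonomy_of_closed {L : C(I, E)} (closed : L 0 = L 1) (t : ℝ) :
    (hQ.foliation h𝒞).HasTrivialHolonomy fun s => Q (L s, t) := by
  obtain ⟨Φ, C, hΦ, hC, hLΦ, hLC⟩ := hQ.exists_chart h𝒞 (L 0) t
  have mem_source : Q (L 0, t) ∈ (foliatedChart Φ C).source :=
    (mem_foliatedChart_source hΦ).2 ⟨_, hLΦ, hLC, rfl⟩
  have chart_apply : foliatedChart Φ C (Q (L 0, t)) = (C (L 0), t) := foliatedChart_apply hΦ C hLΦ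
  have mem_target : (C (L 0), t) ∈ (foliatedChart Φ C).target :=
    chart_apply ▸ (foliatedChart Φ C).map_source mem_source
  obtain ⟨δ, hδ, transversal⟩ := Metric.mem_nhds_iff.1
    ((by fun_prop : Continuous fun s : ℝ => (C (L 0), s)).continuousAt.preimage_mem_nhds
      ((foliatedChart Φ C).open_target.mem_nhds mem_target))
  refine ⟨_, ⟨Φ, hΦ, C, hC, rfl⟩, mem_source, δ, hδ, fun z => Q (L z.1, z.2),
    (hQ.continuous.comp (by fun_prop)).continuousOn, fun s => ?_, fun s hs => ?_⟩
  · dsimp only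
    rw [chart_apply]
  · dsimp only at hs ⊢
    rw [← closed, chart_apply] at *
    exact ⟨hQ.isLeafwise h𝒞 s L.continuous,
      ⟨transversal hs, (foliatedChart_symm_apply hΦ hLC (transversal hs)).symm⟩,
      ⟨transversal hs, (foliatedChart_symm_apply hΦ hLC (transversal hs)).symm⟩⟩

omit [PathConnectedSpace E] [T2Space E] in
lemma exists_family_of_hasTrivialHolonomy {c : I → N} {e : E} {t : ℝ} (h₀ : c 0 = Q (e, t))
    (h₁ : c 1 = Q (e, t)) (trivial_holonomy : (hQ.foliation h𝒞).HasTrivialHolonomy c) :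
    ∃ B ∈ 𝓝 t, ∃ H : I × ℝ → N, ContinuousOn H (univ ×ˢ B) ∧ (∀ s, H (s, t) = c s) ∧
      ∀ t' ∈ B, (hQ.foliation h𝒞).IsLeafwise (fun s => H (s, t')) ∧
        H (0, t') = Q (e, t') ∧ H (1, t') = Q (e, t') := by
  obtain ⟨_, ⟨Φ, hΦ, C, -, rfl⟩, mem_source, δ, hδ, H, hH, hHc, hHB⟩ := trivial_holonomy
  rw [h₀] at mem_source
  obtain ⟨d, hd, hdΦ, hdC⟩ := hQ.exists_deck_mem_source hΦ mem_source
  have chart_apply : foliatedChart Φ C (Q (e, t)) = (C (d.1 e), d.2 t) := by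
    rw [← hd e t, foliatedChart_apply hΦ C hdΦ]
  rw [h₁, h₀, chart_apply] at hHB
  rw [h₀, chart_apply] at hH hHc
  have symm_apply {s : ℝ} (hs : (C (d.1 e), d.2 s) ∈ (foliatedChart Φ C).target) :
      (foliatedChart Φ C).symm (C (d.1 e), d.2 s) = Q (e, s) :=
    (foliatedChart_symm_apply hΦ hdC hs).trans (hd e s)
  refine ⟨d.2 ⁻¹' Metric.ball (d.2 t) δ,
    d.2.continuous.continuousAt.preimage_mem_nhds (Metric.ball_mem_nhds _ hδ),
    fun z => H (z.1, d.2 z.2), ?_, hHc, fun s hs => ?_⟩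
  · exact hH.comp (by fun_prop) fun z hz => ⟨mem_univ _, hz.2⟩
  · obtain ⟨leafwise, ⟨htarget, hH₀⟩, -, hH₁⟩ := hHB (d.2 s) hs
    exact ⟨leafwise, hH₀.trans (symm_apply htarget), hH₁.trans (symm_apply htarget)⟩

lemma closed_of_hasTrivialHolonomy (faithful : HasFaithfulHolonomy Q) {L : C(I, E)} {t : ℝ}
    (hL : Q (L 0, t) = Q (L 1, t))
    (trivial_holonomy : (hQ.foliation h𝒞).HasTrivialHolonomy fun s => Q (L s, t)) : L 0 = L 1 := by
  obtain ⟨B, hB, H, hH, hHL, hHB⟩ :=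
    hQ.exists_family_of_hasTrivialHolonomy h𝒞 rfl hL.symm trivial_holonomy
  obtain ⟨K, hK⟩ := hQ.exists_lift_family h𝒞 hH (fun s hs => (hHB s hs).1)
    (fun s hs => (hHB s hs).2.1)
  have K_end : K (1, ⟨t, mem_of_mem_nhds hB⟩) = L 0 :=
    hQ.eq_of_continuous_section faithful hB (κ := fun s => K (1, s)) (by fun_prop)
      fun s => ((hK s).2 1).trans (hHB s s.2).2.2
  have K_eq_L : (⟨fun s => K (s, ⟨t, mem_of_mem_nhds hB⟩), by fun_prop⟩ : C(I, E)) = L :=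
    hQ.lift_unique (fun s => ((hK _).2 s).trans (hHL s)) (hK _).1
  exact K_end.symm.trans (DFunLike.congr_fun K_eq_L 1)

lemma isHolonomyCover_leafProj (faithful : HasFaithfulHolonomy Q) (e₀ : E) (t : ℝ) :
    (hQ.foliation h𝒞).IsHolonomyCover (Q (e₀, t)) (hQ.leafProj h𝒞 e₀ t) where
  isCoveringMap := (hQ.isQuotientCoveringMap_leafProj h𝒞 e₀ t).isCoveringMap
  pathConnected := inferInstance
  closed_iff _ hL := ⟨fun closed => hQ.hasTrivialHolonomy_of_closed h𝒞 closed t,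
    hQ.closed_of_hasTrivialHolonomy h𝒞 faithful (congrArg Subtype.val hL)⟩

end Lifting

end IsFoliatedCover

lemma SurfaceFoliation.IsHolonomyCover.comp_homeomorph {N E E' : Type*} [TopologicalSpace N]
    [TopologicalSpace E] [TopologicalSpace E'] {F : SurfaceFoliation N} {x : N}
    {pr : E → F.leaf x} (hpr : F.IsHolonomyCover x pr) (f : E' ≃ₜ E) :
    F.IsHolonomyCover x (pr ∘ f) where
  isCoveringMap := hpr.isCoveringMap.comp_homeomorph f
  pathConnected := by
    have := hpr.pathConnected
    exact f.symm.surjective.pathConnectedSpace f.symm.continuous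
  closed_iff _ hL := by
    rw [← f.injective.eq_iff]
    exact hpr.closed_iff ((f : C(E', E)).comp _) hL

lemma IsFoliatedCover.isTypical {N : Type u} {E : Type*} [TopologicalSpace N] [TopologicalSpace E]
    [Small.{u} E] [ContractibleSpace E] [T2Space E] {Q : E × ℝ → N}
    {𝒞 : Set (OpenPartialHomeomorph E (EuclideanHalfSpace 2))} (hQ : IsFoliatedCover Q)
    (h𝒞 : ∀ e, ∃ C ∈ 𝒞, e ∈ C.source) (faithful : HasFaithfulHolonomy Q) :
    (hQ.foliation h𝒞).IsTypical := by
  intro x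
  obtain ⟨⟨e, t⟩, rfl⟩ := hQ.surjective x
  let shrink : Shrink.{u} E ≃ₜ E := (Shrink.homeomorph E).symm
  exact ⟨Shrink.{u} E, inferInstance, _,
    (hQ.isHolonomyCover_leafProj h𝒞 faithful e t).comp_homeomorph shrink,
    shrink.contractibleSpace⟩

/-! ## Homeomorphisms of the line that preserve the integers -/

/-- An increasing continuous function that is the identity outside the unit interval. -/
structure IsUnitMap (u : ℝ → ℝ) : Prop where
  strictMono : StrictMono u
  continuous : Continuous u
  eq_of_le : ∀ t ≤ 0, u t = t
  eq_of_ge : ∀ t, 1 ≤ t → u t = t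

/-- The displacement `g t - t` of a self-map of the unit interval; it vanishes outside the unit
interval if `g` fixes the endpoints. -/
def displacement (g : I ≃ₜ I) (t : ℝ) : ℝ :=
  (g (projIcc 0 1 zero_le_one t) : ℝ) - projIcc 0 1 zero_le_one t

/-- The extension by the identity of an increasing self-map of the unit interval to the line. -/
def unitExtension (g : I ≃ₜ I) (t : ℝ) : ℝ := t + displacement g t

lemma continuous_displacement (g : I ≃ₜ I) : Continuous (displacement g) := by
  have : Continuous (projIcc (0 : ℝ) 1 zero_le_one) := continuous_projIcc
  unfold displacement
  fun_prop

section UnitExtension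

variable {g g' : I ≃ₜ I}

lemma monotone_homeomorph_zero (hg : Monotone g) : g 0 = 0 :=
  (hg.strictMono_of_injective g.injective).orderIsoOfSurjective g g.surjective |>.map_bot

lemma monotone_homeomorph_one (hg : Monotone g) : g 1 = 1 :=
  (hg.strictMono_of_injective g.injective).orderIsoOfSurjective g g.surjective |>.map_top

lemma displacement_of_le (hg : Monotone g) {t : ℝ} (ht : t ≤ 0) : displacement g t = 0 := by
  have proj_eq : projIcc (0 : ℝ) 1 zero_le_one t = (0 : I) := projIcc_of_le_left _ ht
  rw [displacement, proj_eq, monotone_homeomorph_zero hg, sub_self]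

lemma displacement_of_ge (hg : Monotone g) {t : ℝ} (ht : 1 ≤ t) : displacement g t = 0 := by
  have proj_eq : projIcc (0 : ℝ) 1 zero_le_one t = (1 : I) := projIcc_of_right_le _ ht
  rw [displacement, proj_eq, monotone_homeomorph_one hg, sub_self]

lemma unitExtension_coe (g : I ≃ₜ I) (t : I) : unitExtension g t = g t := by
  simp [unitExtension, displacement]

lemma strictMono_unitExtension (hg : Monotone g) : StrictMono (unitExtension g) := by
  intro a b hab
  simp only [unitExtension, displacement]
  rcases (monotone_projIcc (zero_le_one (α := ℝ)) hab.le).lt_or_eq with proj_lt | proj_eq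
  · have map_lt : (g (projIcc 0 1 zero_le_one a) : ℝ) < g (projIcc 0 1 zero_le_one b) :=
      hg.strictMono_of_injective g.injective proj_lt
    have proj_sub_le := (LipschitzWith.projIcc (zero_le_one (α := ℝ))).dist_le_mul b a
    rw [NNReal.coe_one, one_mul, Subtype.dist_eq, Real.dist_eq, Real.dist_eq,
      abs_of_pos (sub_pos.2 hab)] at proj_sub_le
    linarith [le_of_abs_le proj_sub_le]
  · rw [proj_eq]
    linarith

lemma isUnitMap_unitExtension (hg : Monotone g) : IsUnitMap (unitExtension g) where
  strictMono := strictMono_unitExtension hg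
  continuous := continuous_id.add (continuous_displacement g)
  eq_of_le t ht := by rw [unitExtension, displacement_of_le hg ht, add_zero]
  eq_of_ge t ht := by rw [unitExtension, displacement_of_ge hg ht, add_zero]

lemma unitExtension_one (t : ℝ) : unitExtension 1 t = t := by
  simp [unitExtension, displacement]

lemma unitExtension_mul (hg : Monotone g) (hg' : Monotone g') (t : ℝ) :
    unitExtension (g * g') t = unitExtension g (unitExtension g' t) := by
  have isUnitMap_mul := isUnitMap_unitExtension (g := g * g') (hg.comp hg')
  have isUnitMap_left := isUnitMap_unitExtension hg
  have isUnitMap_right := isUnitMap_unitExtension hg'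
  rcases le_or_gt t 0 with h | h
  · rw [isUnitMap_mul.eq_of_le t h, isUnitMap_right.eq_of_le t h, isUnitMap_left.eq_of_le t h]
  rcases le_or_gt 1 t with h' | h'
  · rw [isUnitMap_mul.eq_of_ge t h', isUnitMap_right.eq_of_ge t h', isUnitMap_left.eq_of_ge t h']
  lift t to I using ⟨h.le, h'.le⟩
  simp only [unitExtension_coe]
  rfl

end UnitExtension

namespace IsUnitMap

variable {u : ℝ → ℝ}

lemma nonneg (hu : IsUnitMap u) {t : ℝ} (ht : 0 ≤ t) : 0 ≤ u t :=
  (hu.eq_of_le 0 le_rfl).ge.trans (hu.strictMono.monotone ht)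

lemma lt_one (hu : IsUnitMap u) {t : ℝ} (ht : t < 1) : u t < 1 :=
  (hu.strictMono ht).trans_eq (hu.eq_of_ge 1 le_rfl)

lemma sum {ι : Type*} [Fintype ι] {v : ι → ℝ → ℝ} (hv : ∀ i, IsUnitMap (v i)) {a : ι → ℝ}
    (nonneg : ∀ i, 0 ≤ a i) (sum_eq_one : ∑ i, a i = 1) :
    IsUnitMap fun t => ∑ i, a i * v i t where
  strictMono := by
    intro s t hst
    obtain ⟨j, -, hj⟩ : ∃ j ∈ Finset.univ, 0 < a j :=
      Finset.exists_lt_of_sum_lt (by simp [sum_eq_one])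
    exact Finset.sum_lt_sum
      (fun i _ => mul_le_mul_of_nonneg_left ((hv i).strictMono.monotone hst.le) (nonneg i))
      ⟨j, Finset.mem_univ j, mul_lt_mul_of_pos_left ((hv j).strictMono hst) hj⟩
  continuous := continuous_finsetSum _ fun i _ => continuous_const.mul (hv i).continuous
  eq_of_le t ht := by
    simp only [fun i => (hv i).eq_of_le t ht]
    rw [← Finset.sum_mul, sum_eq_one, one_mul]
  eq_of_ge t ht := by
    simp only [fun i => (hv i).eq_of_ge t ht]
    rw [← Finset.sum_mul, sum_eq_one, one_mul]

end IsUnitMap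

/-- The function which on `[n, n + 1]` is the conjugate of `u n` by the translation by `n`. -/
def assemble (u : ℤ → ℝ → ℝ) (t : ℝ) : ℝ := ⌊t⌋ + u ⌊t⌋ (Int.fract t)

section Assemble

variable {u v : ℤ → ℝ → ℝ}

lemma assemble_sub_int (u : ℤ → ℝ → ℝ) (t : ℝ) (m : ℤ) :
    assemble (fun n => u (n + m)) (t - m) = assemble u t - m := by
  simp only [assemble, Int.floor_sub_intCast, Int.fract_sub_intCast, sub_add_cancel]
  push_cast
  ring

lemma floor_assemble (hu : ∀ n, IsUnitMap (u n)) (t : ℝ) : ⌊assemble u t⌋ = ⌊t⌋ := by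
  rw [Int.floor_eq_iff, assemble]
  have nonneg := (hu ⌊t⌋).nonneg (Int.fract_nonneg t)
  have lt_one := (hu ⌊t⌋).lt_one (Int.fract_lt_one t)
  constructor <;> linarith

lemma assemble_comp (hv : ∀ n, IsUnitMap (v n)) (t : ℝ) :
    assemble (fun n t => u n (v n t)) t = assemble u (assemble v t) := by
  have fract_eq : Int.fract (assemble v t) = v ⌊t⌋ (Int.fract t) := by
    rw [Int.fract, floor_assemble hv, assemble, add_sub_cancel_left]
  rw [assemble, assemble, fract_eq, floor_assemble hv]

lemma strictMono_assemble (hu : ∀ n, IsUnitMap (u n)) : StrictMono (assemble u) := by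
  intro s t hst
  rcases (Int.floor_mono hst.le).lt_or_eq with floor_lt | floor_eq
  · refine Int.floor_mono.reflect_lt ?_
    rwa [floor_assemble hu, floor_assemble hu]
  · have fract_lt : Int.fract s < Int.fract t := by
      rw [Int.fract, Int.fract, floor_eq]
      exact sub_lt_sub_right hst _
    rw [assemble, assemble, floor_eq]
    exact add_lt_add_right ((hu ⌊t⌋).strictMono fract_lt) _

/-- On a neighbourhood of the integer `n` both neighbouring unit intervals contribute, but in each
point one of the two displacements vanishes. -/
lemma assemble_eq_on_Ioo (hu : ∀ n, IsUnitMap (u n)) {n : ℤ} {t : ℝ}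
    (ht : t ∈ Ioo ((n : ℝ) - 1) (n + 1)) :
    assemble u t = t + (u n (t - n) - (t - n)) + (u (n - 1) (t - n + 1) - (t - n + 1)) := by
  obtain ⟨lower, upper⟩ := ht
  rcases le_or_gt (n : ℝ) t with h | h
  · have floor_eq : ⌊t⌋ = n := Int.floor_eq_iff.2 ⟨h, upper⟩
    rw [assemble, Int.fract, floor_eq, (hu (n - 1)).eq_of_ge (t - n + 1) (by linarith)]
    ring
  · have floor_eq : ⌊t⌋ = n - 1 :=
      Int.floor_eq_iff.2 ⟨by push_cast; linarith, by push_cast; linarith⟩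
    rw [assemble, Int.fract, floor_eq, (hu n).eq_of_le (t - n) (by linarith), Int.cast_sub,
      Int.cast_one, ← sub_add]
    ring

lemma assemble_eq_on_Icc (hu : ∀ n, IsUnitMap (u n)) {t : ℝ} (ht : t ∈ Icc (0 : ℝ) 1) :
    assemble u t = u 0 t := by
  rcases ht.2.lt_or_eq with h | rfl
  · have floor_eq : ⌊t⌋ = 0 := Int.floor_eq_zero_iff.2 ⟨ht.1, h⟩
    rw [assemble, Int.fract, floor_eq, Int.cast_zero, zero_add, sub_zero]
  · rw [assemble, Int.floor_one, Int.fract_one, (hu 0).eq_of_ge 1 le_rfl, (hu 1).eq_of_le 0 le_rfl,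
      Int.cast_one, add_zero]

lemma mem_Ioo_floor (t : ℝ) : t ∈ Ioo ((⌊t⌋ : ℝ) - 1) (⌊t⌋ + 1) :=
  ⟨by linarith [Int.floor_le t], Int.lt_floor_add_one t⟩

lemma continuous_assemble (hu : ∀ n, IsUnitMap (u n)) : Continuous (assemble u) := by
  rw [continuous_iff_continuousAt]
  intro t
  have near_eq := eventually_of_mem (isOpen_Ioo.mem_nhds (mem_Ioo_floor t))
    fun s hs => assemble_eq_on_Ioo hu hs
  refine ContinuousAt.congr ?_ (near_eq.mono fun s hs => hs.symm)
  have continuous_upper := (hu ⌊t⌋).continuous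
  have continuous_lower := (hu (⌊t⌋ - 1)).continuous
  fun_prop

lemma surjective_of_floor_eq {f : ℝ → ℝ} (hf : Continuous f) (floor_eq : ∀ t, ⌊f t⌋ = ⌊t⌋) :
    Function.Surjective f := by
  have lower (t : ℝ) : t + -1 ≤ f t := by
    have floor_le := Int.floor_le (f t)
    rw [floor_eq] at floor_le
    linarith [Int.lt_floor_add_one t]
  have upper (t : ℝ) : f t ≤ t + 1 := by
    have lt_floor := Int.lt_floor_add_one (f t)
    rw [floor_eq] at lt_floor
    linarith [Int.floor_le t]
  exact hf.surjective
    (tendsto_atTop_mono lower (tendsto_atTop_add_const_right _ (-1) tendsto_id))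
    (tendsto_atBot_mono upper (tendsto_atBot_add_const_right _ 1 tendsto_id))

/-- The homeomorphism of the line which on `[n, n + 1]` is the conjugate of the homeomorphism `f n`
of the unit interval by the translation by `n`. -/
def assembleHomeomorph (f : ℤ → I ≃ₜ I) (hf : ∀ n, Monotone (f n)) : ℝ ≃ₜ ℝ :=
  ((strictMono_assemble fun n => isUnitMap_unitExtension (hf n)).orderIsoOfSurjective _
    (surjective_of_floor_eq (continuous_assemble fun n => isUnitMap_unitExtension (hf n))
      (floor_assemble fun n => isUnitMap_unitExtension (hf n)))).toHomeomorph

variable {f : ℤ → I ≃ₜ I}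

lemma assembleHomeomorph_apply (hf : ∀ n, Monotone (f n)) (t : ℝ) :
    assembleHomeomorph f hf t = assemble (fun n => unitExtension (f n)) t := rfl

lemma floor_assembleHomeomorph (hf : ∀ n, Monotone (f n)) (t : ℝ) :
    ⌊assembleHomeomorph f hf t⌋ = ⌊t⌋ :=
  floor_assemble (fun n => isUnitMap_unitExtension (hf n)) t

lemma assembleHomeomorph_coe (hf : ∀ n, Monotone (f n)) (t : I) :
    assembleHomeomorph f hf t = f 0 t := by
  rw [assembleHomeomorph_apply, assemble_eq_on_Icc (fun n => isUnitMap_unitExtension (hf n)) t.2,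
    unitExtension_coe]

lemma eventually_fixed_of_assembleHomeomorph (hf : ∀ n, Monotone (f n)) {t : ℝ}
    (fixed : ∀ᶠ s in 𝓝 t, assembleHomeomorph f hf s = s) :
    ∃ θ : I, 0 < θ ∧ θ < 1 ∧ ∀ᶠ θ' in 𝓝 θ, f ⌊t⌋ θ' = θ' := by
  have right_near : ∀ᶠ s : ℝ in 𝓝[>] t,
      s < ⌊t⌋ + 1 ∧ ∀ᶠ r in 𝓝 s, assembleHomeomorph f hf r = r :=
    ((eventually_lt_nhds (Int.lt_floor_add_one t)).and fixed.eventually_nhds).filter_mono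
      nhdsWithin_le_nhds
  obtain ⟨s, ⟨lt_succ, near⟩, lt⟩ := (right_near.and eventually_mem_nhdsWithin).exists
  have floor_lt : (⌊t⌋ : ℝ) < s := (Int.floor_le t).trans_lt lt
  let θ : I := ⟨s - ⌊t⌋, by linarith, by linarith⟩
  have pos : 0 < θ := by rw [← Subtype.coe_lt_coe]; exact sub_pos.2 floor_lt
  have lt_one : θ < 1 := by rw [← Subtype.coe_lt_coe]; exact sub_left_lt_of_lt_add lt_succ
  refine ⟨θ, pos, lt_one, ?_⟩
  have shift : Tendsto (fun θ' : I => (⌊t⌋ : ℝ) + θ') (𝓝 θ) (𝓝 s) :=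
    (by fun_prop : Continuous fun θ' : I => (⌊t⌋ : ℝ) + θ').tendsto' _ _ (add_sub_cancel _ _)
  filter_upwards [shift.eventually near, eventually_lt_nhds lt_one] with θ' hθ' hlt
  have floor_eq : ⌊(⌊t⌋ : ℝ) + θ'⌋ = ⌊t⌋ :=
    Int.floor_eq_iff.2 ⟨by linarith [θ'.2.1], by linarith [show (θ' : ℝ) < 1 from hlt]⟩
  rw [assembleHomeomorph_apply, assemble, Int.fract, floor_eq, add_sub_cancel_left,
    unitExtension_coe] at hθ'
  exact Subtype.ext (add_left_cancel hθ')

end Assemble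

/-! ## Lifting to a contractible covering -/

section Lifting

variable {S E : Type*} [TopologicalSpace S] [TopologicalSpace E] {p : E → S}

lemma exists_continuous_lift {A : Type*} [TopologicalSpace A] [ContractibleSpace A]
    (hp : IsCoveringMap p) (surj : Function.Surjective p) {f : A → S} (hf : Continuous f) :
    ∃ F : A → E, Continuous F ∧ ∀ a, p (F a) = f a := by
  obtain ⟨a₀, ⟨H⟩⟩ := id_nullhomotopic A
  obtain ⟨e, he⟩ := surj (f a₀)
  let K : C(I × A, S) := ⟨fun z => f (H (unitInterval.symm z.1, z.2)), by fun_prop⟩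
  have start (a : A) : K (0, a) = p (ContinuousMap.const A e a) := by
    change f (H (unitInterval.symm 0, a)) = p e
    rw [unitInterval.symm_zero, H.apply_one, he]
    rfl
  refine ⟨fun a => hp.liftHomotopy K (ContinuousMap.const A e) start (1, a), by fun_prop,
    fun a => (congrFun (hp.liftHomotopy_lifts K (ContinuousMap.const A e) start) (1, a)).trans ?_⟩
  change f (H (unitInterval.symm 1, a)) = f a
  rw [unitInterval.symm_one, H.apply_zero]
  rfl

lemma t2Space_of_isCoveringMap [T2Space S] (hp : IsCoveringMap p) : T2Space E := by
  refine ⟨fun x y ne => ?_⟩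
  by_cases h : p x = p y
  · exact hp.isSeparatedMap x y h ne
  · exact separated_by_continuous hp.continuous h

variable {G : Type*} [Group G] [MulAction G E]

lemma eq_of_smul_eq_smul (hp : IsQuotientCoveringMap p G) {g g' : G} {e : E}
    (h : g • e = g' • e) : g = g' :=
  hp.isCancelSMul.right_cancel _ _ _ h

lemma exists_smul_eq_of_proj_eq (hp : IsQuotientCoveringMap p G) {e e' : E} (h : p e = p e') :
    ∃ g : G, g • e = e' :=
  hp.apply_eq_iff_mem_orbit.1 h.symm

lemma eq_of_proj_eq_of_apply_eq [PreconnectedSpace E] (hp : IsQuotientCoveringMap p G)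
    {ψ ψ' : E → E} (hψ : Continuous ψ) (hψ' : Continuous ψ') (proj_eq : ∀ e, p (ψ e) = p (ψ' e))
    {e₀ : E} (base : ψ e₀ = ψ' e₀) : ψ = ψ' :=
  hp.isCoveringMap.eq_of_comp_eq hψ hψ' (funext proj_eq) e₀ base

lemma exists_eq_smul_of_proj_eq [ConnectedSpace E] (hp : IsQuotientCoveringMap p G) {ψ : E → E}
    (hψ : Continuous ψ) (proj_eq : ∀ e, p (ψ e) = p e) : ∃ g : G, ∀ e, ψ e = g • e := by
  have := hp.toContinuousConstSMul
  have e₀ : E := Classical.arbitrary E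
  obtain ⟨g, hg⟩ := exists_smul_eq_of_proj_eq hp (proj_eq e₀).symm
  exact ⟨g, congrFun (eq_of_proj_eq_of_apply_eq hp hψ (continuous_const_smul g)
    (fun e => by rw [proj_eq, hp.map_smul]) hg.symm)⟩

lemma exists_homeomorph_lift [ContractibleSpace E] (hp : IsQuotientCoveringMap p G) (φ : S ≃ₜ S) :
    ∃ ψ : E ≃ₜ E, ∀ e, p (ψ e) = φ (p e) := by
  have := hp.toContinuousConstSMul
  have continuous_proj := hp.isCoveringMap.continuous
  obtain ⟨F, hF, lift_F⟩ := exists_continuous_lift hp.isCoveringMap hp.surjective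
    (φ.continuous.comp continuous_proj)
  obtain ⟨F', hF', lift_F'⟩ := exists_continuous_lift hp.isCoveringMap hp.surjective
    (φ.symm.continuous.comp continuous_proj)
  obtain ⟨g, hg⟩ : ∃ g : G, ∀ e, F' (F e) = g • e :=
    exists_eq_smul_of_proj_eq hp (hF'.comp hF) fun e => by simp [lift_F, lift_F']
  obtain ⟨g', hg'⟩ : ∃ g : G, ∀ e, F (F' e) = g • e :=
    exists_eq_smul_of_proj_eq hp (hF.comp hF') fun e => by simp [lift_F, lift_F']
  have bijective_F : Function.Bijective F := by
    constructor
    · exact Function.LeftInverse.injective (g := fun e => g⁻¹ • F' e) fun e => by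
        simp only [hg, inv_smul_smul]
    · exact Function.RightInverse.surjective (g := fun e => F' (g'⁻¹ • e)) fun e => by
        simp only [hg', smul_inv_smul]
  refine ⟨⟨Equiv.ofBijective F bijective_F, hF, ?_⟩, lift_F⟩
  have symm_eq : ⇑(Equiv.ofBijective F bijective_F).symm = fun e => g⁻¹ • F' e := by
    funext e
    rw [Equiv.symm_apply_eq, Equiv.ofBijective_apply]
    obtain ⟨e', rfl⟩ := bijective_F.surjective e
    rw [hg, inv_smul_smul]
  change Continuous (Equiv.ofBijective F bijective_F).symm
  exact symm_eq ▸ hF'.const_smul g⁻¹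

lemma exists_monoidHom_smul [ConnectedSpace E] (hp : IsQuotientCoveringMap p G) {ψ : E → E}
    (hψ : Continuous ψ) {χ : S → S} (lift : ∀ e, p (ψ e) = χ (p e)) :
    ∃ c : G →* G, ∀ g e, ψ (g • e) = c g • ψ e := by
  have := hp.toContinuousConstSMul
  have e₀ : E := Classical.arbitrary E
  have exists_smul (g : G) : ∃ g' : G, ∀ e, ψ (g • e) = g' • ψ e := by
    have proj_eq (e : E) : p (ψ (g • e)) = p (ψ e) := by rw [lift, lift, hp.map_smul]
    obtain ⟨g', hg'⟩ := exists_smul_eq_of_proj_eq hp (proj_eq e₀).symm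
    exact ⟨g', congrFun (eq_of_proj_eq_of_apply_eq hp (ψ := fun e => ψ (g • e)) (by fun_prop)
      (by fun_prop) (fun e => by rw [proj_eq, hp.map_smul]) hg'.symm)⟩
  choose c hc using exists_smul
  refine ⟨MonoidHom.mk' c fun g g' => eq_of_smul_eq_smul hp (e := ψ e₀) ?_, hc⟩
  rw [← hc, mul_smul, mul_smul, hc, hc]

lemma injective_of_smul_eq [Nonempty E] (hp : IsQuotientCoveringMap p G) {ψ : E → E}
    (hψ : Function.Injective ψ) {c : G → G} (hc : ∀ g e, ψ (g • e) = c g • ψ e) :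
    Function.Injective c := by
  intro g g' h
  refine eq_of_smul_eq_smul hp (e := Classical.arbitrary E) (hψ ?_)
  rw [hc, hc, h]

/-- The isomorphism of the fundamental group of the base of a simply connected covering with the
group of deck transformations. In order to be multiplicative, it sends the class of a loop whose
lift starts at `e₀` and ends at `g • e₀` to `g⁻¹`. -/
def fundamentalGroupEquivDeck [SimplyConnectedSpace E] (hp : IsQuotientCoveringMap p G) (e₀ : E) :
    FundamentalGroup S (p e₀) ≃* G :=
  (hp.fundamentalGroupEquiv ⟨e₀, rfl⟩).trans (MulEquiv.inv' G).symm

lemma fundamentalGroupEquivDeck_fromPath [SimplyConnectedSpace E] (hp : IsQuotientCoveringMap p G)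
    {e₀ : E} {γ : Path (p e₀) (p e₀)} {L : C(I, E)} {g : G} (start : L 0 = e₀)
    (lift : ∀ s, p (L s) = γ s) (finish : L 1 = g • e₀) :
    fundamentalGroupEquivDeck hp e₀
      (FundamentalGroup.fromPath (Path.Homotopic.Quotient.mk γ)) = g⁻¹ := by
  have monodromy_eq : hp.fundamentalGroupEquiv ⟨e₀, rfl⟩
      (FundamentalGroup.fromPath (Path.Homotopic.Quotient.mk γ)) = MulOpposite.op g := by
    refine hp.fundamentalGroupToMulOpposite_apply_eq_Iff.2 ?_
    have L_eq := (hp.isCoveringMap.eq_liftPath_iff' (γ := (γ : C(I, S))) (e := e₀) γ.source).2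
      ⟨funext lift, start⟩
    rw [MulOpposite.unop_op, ← finish, L_eq]
    rfl
  exact congrArg (MulEquiv.inv' G).symm monodromy_eq

end Lifting

lemma proj_zpow {S E : Type*} [TopologicalSpace E] {p : E → S} {ψ : E ≃ₜ E}
    {χ : Equiv.Perm S} (lift : ∀ e, p (ψ e) = χ (p e)) (n : ℤ) (e : E) :
    p ((ψ ^ n) e) = (χ ^ n) (p e) := by
  have lift_inv (e : E) : p (ψ⁻¹ e) = χ⁻¹ (p e) :=
    χ.injective (by rw [← lift]; simp)
  induction n using Int.induction_on generalizing e with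
  | zero => rfl
  | succ n ih =>
    rw [zpow_add_one, zpow_add_one]
    exact (ih (ψ e)).trans (by rw [lift]; rfl)
  | pred n ih =>
    rw [zpow_sub_one, zpow_sub_one]
    exact (ih (ψ⁻¹ e)).trans (by rw [lift_inv]; rfl)

/-- A partition of unity on `S` subordinate to the images of sheets of the covering `p`, together
with the group elements that move the points of `E` to these sheets, normalized to be trivial at
`e₀`. Where a function of the partition vanishes, its group element carries no information. -/
structure SheetPartition {S E : Type*} (G : Type*) [TopologicalSpace S] [TopologicalSpace E]
    [Group G] [MulAction G E] (p : E → S) (e₀ : E) (ι : Type*) [Fintype ι] where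
  weight : ι → S → ℝ
  continuous_weight : ∀ i, Continuous (weight i)
  nonneg : ∀ i x, 0 ≤ weight i x
  sum_eq_one : ∀ x, ∑ i, weight i x = 1
  sheet : ι → E → G
  eventually_sheet : ∀ i e, ∃ g : G, ∀ᶠ e' in 𝓝 e, weight i (p e') = 0 ∨ sheet i e' = g
  sheet_smul : ∀ i e (g : G), weight i (p e) = 0 ∨ sheet i (g • e) = sheet i e * g⁻¹
  sheet_base : ∀ i, sheet i e₀ = 1

/-- An open set that is disjoint from its translates by the nontrivial elements of the group. -/
structure IsSheet {E : Type*} (G : Type*) [TopologicalSpace E] [Group G] [MulAction G E]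
    (V : Set E) : Prop where
  isOpen : IsOpen V
  eq_one_of_smul_mem : ∀ e ∈ V, ∀ g : G, g • e ∈ V → g = 1

open Classical in
/-- The group element that moves the point `e` to the sheet `V`, or `1` if there is none. -/
def sheetIndex {E : Type*} (G : Type*) [Group G] [MulAction G E] (V : Set E) (e : E) : G :=
  if h : ∃ g : G, g • e ∈ V then h.choose else 1

section Sheets

variable {S E G : Type*} [TopologicalSpace S] [TopologicalSpace E] [Group G] [MulAction G E]
  {p : E → S} {V : Set E}

lemma exists_isSheet (hp : IsQuotientCoveringMap p G) (e : E) : ∃ V, IsSheet G V ∧ e ∈ V := by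
  obtain ⟨U, hU, disjoint⟩ := hp.disjoint e
  obtain ⟨V, hVU, isOpen, mem⟩ := mem_nhds_iff.1 hU
  exact ⟨V, ⟨isOpen, fun e' he' g hg => disjoint g ⟨g • e', mem_image_of_mem _ (hVU he'), hVU hg⟩⟩,
    mem⟩

lemma IsSheet.sheetIndex_eq (hV : IsSheet G V) {e : E} {g : G} (mem : g • e ∈ V) :
    sheetIndex G V e = g := by
  have exists_mem : ∃ g : G, g • e ∈ V := ⟨g, mem⟩
  rw [sheetIndex, dif_pos exists_mem, ← mul_inv_eq_one]
  refine hV.eq_one_of_smul_mem _ mem _ ?_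
  rw [smul_smul, inv_mul_cancel_right]
  exact exists_mem.choose_spec

lemma exists_smul_mem_of_proj_mem (hp : IsQuotientCoveringMap p G) {e : E} (he : p e ∈ p '' V) :
    ∃ g : G, g • e ∈ V := by
  obtain ⟨e', mem, proj_eq⟩ := he
  obtain ⟨g, rfl⟩ := exists_smul_eq_of_proj_eq hp proj_eq.symm
  exact ⟨g, mem⟩

lemma IsSheet.exists_eventually_sheetIndex (hp : IsQuotientCoveringMap p G) (hV : IsSheet G V)
    {w : S → ℝ} (hw : tsupport w ⊆ p '' V) (e : E) :
    ∃ g : G, ∀ᶠ e' in 𝓝 e, w (p e') = 0 ∨ sheetIndex G V e' = g := by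
  have := hp.toContinuousConstSMul
  by_cases h : p e ∈ p '' V
  · obtain ⟨g, hg⟩ := exists_smul_mem_of_proj_mem hp h
    have near : ∀ᶠ e' in 𝓝 e, g • e' ∈ V :=
      (continuous_const_smul g).continuousAt.eventually (hV.isOpen.mem_nhds hg)
    exact ⟨g, near.mono fun e' he' => Or.inr (hV.sheetIndex_eq he')⟩
  · have near : ∀ᶠ e' in 𝓝 e, p e' ∈ (tsupport w)ᶜ :=
      hp.isCoveringMap.continuous.continuousAt.eventually
        ((isClosed_tsupport w).isOpen_compl.mem_nhds fun h' => h (hw h'))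
    exact ⟨1, near.mono fun e' he' => Or.inl (image_eq_zero_of_notMem_tsupport he')⟩

lemma IsSheet.sheetIndex_smul (hp : IsQuotientCoveringMap p G) (hV : IsSheet G V) {e : E}
    (he : p e ∈ p '' V) (g : G) : sheetIndex G V (g • e) = sheetIndex G V e * g⁻¹ := by
  obtain ⟨g', hg'⟩ := exists_smul_mem_of_proj_mem hp he
  rw [hV.sheetIndex_eq hg', hV.sheetIndex_eq (g := g' * g⁻¹)]
  rwa [smul_smul, inv_mul_cancel_right]

/-- The sheet partition given by a partition of unity subordinate to the images of sheets. -/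
def SheetPartition.ofSubordinate {ι : Type*} [Fintype ι] (hp : IsQuotientCoveringMap p G) (e₀ : E)
    {V : ι → Set E} (hV : ∀ i, IsSheet G (V i)) (w : ι → S → ℝ) (hw : ∀ i, Continuous (w i))
    (nonneg : ∀ i x, 0 ≤ w i x) (sum_eq_one : ∀ x, ∑ i, w i x = 1)
    (subordinate : ∀ i, tsupport (w i) ⊆ p '' V i) : SheetPartition G p e₀ ι where
  weight := w
  continuous_weight := hw
  nonneg := nonneg
  sum_eq_one := sum_eq_one
  sheet i e := (sheetIndex G (V i) e₀)⁻¹ * sheetIndex G (V i) e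
  eventually_sheet i e := by
    obtain ⟨g, hg⟩ := (hV i).exists_eventually_sheetIndex hp (subordinate i) e
    exact ⟨(sheetIndex G (V i) e₀)⁻¹ * g, hg.mono fun e' => Or.imp_right fun h => by rw [h]⟩
  sheet_smul i e g := by
    refine or_iff_not_imp_left.2 fun ne => ?_
    rw [(hV i).sheetIndex_smul hp (subordinate i (subset_tsupport _ ne)), mul_assoc]
  sheet_base i := inv_mul_cancel _

theorem exists_contMDiff_sheetPartition {F H : Type*} [NormedAddCommGroup F] [NormedSpace ℝ F]
    [FiniteDimensional ℝ F] [TopologicalSpace H] (J : ModelWithCorners ℝ F H) [ChartedSpace H S]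
    [IsManifold J ∞ S] [CompactSpace S] [T2Space S] (hp : IsQuotientCoveringMap p G) (e₀ : E) :
    ∃ (T : Finset E) (P : SheetPartition G p e₀ T), ∀ i, ContMDiff J 𝓘(ℝ, ℝ) ∞ (P.weight i) := by
  choose V hV mem using exists_isSheet hp
  have isOpen_image (e : E) : IsOpen (p '' V e) := hp.isCoveringMap.isOpenMap _ (hV e).isOpen
  obtain ⟨T, cover⟩ := isCompact_univ.elim_finite_subcover (fun e => p '' V e) isOpen_image
    (fun x _ => by
      obtain ⟨e, rfl⟩ := hp.surjective x
      exact mem_iUnion.2 ⟨e, mem_image_of_mem p (mem e)⟩)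
  obtain ⟨w, subordinate⟩ := SmoothPartitionOfUnity.exists_isSubordinate J isClosed_univ
    (fun i : T => p '' V i) (fun i => isOpen_image i) (by rwa [iUnion_subtype])
  exact ⟨T, SheetPartition.ofSubordinate hp e₀ (fun i => hV i) (fun i => w i)
    (fun i => (w i).contMDiff.continuous) w.nonneg
    (fun x => (finsum_eq_sum_of_fintype _).symm.trans (w.sum_eq_one (mem_univ x)))
    subordinate, fun i => (w i).contMDiff⟩

end Sheets

/-! ## The heights of the leaves of a suspension -/

/-- The homeomorphism of `E × ℝ` that restricts to the increasing bijection `f e` of each line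
`{e} × ℝ`. -/
def fiberwiseHomeomorph {E : Type*} [TopologicalSpace E] (f : E → ℝ → ℝ)
    (hf : Continuous fun z : E × ℝ => f z.1 z.2) (strictMono : ∀ e, StrictMono (f e))
    (surj : ∀ e, Function.Surjective (f e)) : E × ℝ ≃ₜ E × ℝ where
  toFun z := (z.1, f z.1 z.2)
  invFun z := (z.1, ((strictMono z.1).orderIsoOfSurjective _ (surj z.1)).symm z.2)
  left_inv z := Prod.ext rfl (OrderIso.symm_apply_apply _ z.2)
  right_inv z := Prod.ext rfl
    (((strictMono z.1).orderIsoOfSurjective _ (surj z.1)).apply_symm_apply z.2)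
  continuous_toFun := continuous_fst.prodMk hf
  continuous_invFun := by
    refine continuous_fst.prodMk (continuous_iff_continuousAt.2 fun z => ?_)
    have continuous_slice (a : ℝ) : Continuous fun w : E × ℝ => f w.1 a :=
      hf.comp (by fun_prop : Continuous fun w : E × ℝ => (w.1, a))
    refine tendsto_order.2 ⟨fun a ha => ?_, fun a ha => ?_⟩
    · rw [OrderIso.lt_symm_apply] at ha
      filter_upwards [(isOpen_lt (continuous_slice a) continuous_snd).mem_nhds ha] with w hw
      exact (OrderIso.lt_symm_apply _).2 hw
    · rw [gt_iff_lt, OrderIso.symm_apply_lt] at ha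
      filter_upwards [(isOpen_lt continuous_snd (continuous_slice a)).mem_nhds ha] with w hw
      exact (OrderIso.symm_apply_lt _).2 hw

section Heights

variable {S E G ι : Type*} [TopologicalSpace S] [TopologicalSpace E] [Group G] [MulAction G E]
  [Fintype ι] {p : E → S} {e₀ : E} (P : SheetPartition G p e₀ ι) (κ : G →* (I ≃ₜ I))

/-- The height over the point `e` of the leaf of the suspension of `κ` that has height `t` over the
base point, extended by the identity from the unit interval to all `t`. -/
def fiberHeight (e : E) (t : ℝ) : ℝ :=
  ∑ i, P.weight i (p e) * unitExtension (κ (P.sheet i e)) t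

variable {κ}

lemma isUnitMap_fiberHeight (hκ : ∀ g, Monotone (κ g)) (e : E) : IsUnitMap (fiberHeight P κ e) :=
  IsUnitMap.sum (fun _ => isUnitMap_unitExtension (hκ _)) (fun i => P.nonneg i _)
    (P.sum_eq_one _)

lemma fiberHeight_base (t : ℝ) : fiberHeight P κ e₀ t = t := by
  simp only [fiberHeight, P.sheet_base, map_one, unitExtension_one]
  rw [← Finset.sum_mul, P.sum_eq_one, one_mul]

lemma fiberHeight_smul (hp : IsQuotientCoveringMap p G) (hκ : ∀ g, Monotone (κ g)) (g : G) (e : E)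
    (t : ℝ) : fiberHeight P κ (g • e) (unitExtension (κ g) t) = fiberHeight P κ e t := by
  refine Finset.sum_congr rfl fun i _ => ?_
  rw [hp.map_smul]
  rcases P.sheet_smul i e g with weight_eq | sheet_eq
  · rw [weight_eq, zero_mul, zero_mul]
  · rw [sheet_eq, ← unitExtension_mul (hκ _) (hκ _), ← map_mul, inv_mul_cancel_right]

variable (κ) in
lemma exists_eventually_fiberHeight_eq (e : E) : ∃ g : ι → G, ∀ᶠ e' in 𝓝 e, ∀ t,
    fiberHeight P κ e' t = ∑ i, P.weight i (p e') * unitExtension (κ (g i)) t := by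
  choose g hg using fun i => P.eventually_sheet i e
  refine ⟨g, (eventually_all.2 hg).mono fun e' near t => Finset.sum_congr rfl fun i _ => ?_⟩
  rcases near i with weight_eq | sheet_eq
  · rw [weight_eq, zero_mul, zero_mul]
  · rw [sheet_eq]

lemma continuous_fiberHeight (hp : Continuous p) (hκ : ∀ g, Monotone (κ g)) :
    Continuous fun z : E × ℝ => fiberHeight P κ z.1 z.2 := by
  rw [continuous_iff_continuousAt]
  intro z
  obtain ⟨g, hg⟩ := exists_eventually_fiberHeight_eq P κ z.1
  have near_eq : ∀ᶠ w in 𝓝 z, fiberHeight P κ w.1 w.2 =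
      ∑ i, P.weight i (p w.1) * unitExtension (κ (g i)) w.2 :=
    (continuous_fst.continuousAt.eventually hg).mono fun w hw => hw w.2
  refine ContinuousAt.congr ?_ (near_eq.mono fun w hw => hw.symm)
  have continuous_weight := P.continuous_weight
  have continuous_extension := fun i => (isUnitMap_unitExtension (hκ (g i))).continuous
  fun_prop

variable (κ) (ψ : E ≃ₜ E)

/-- The height over the point `e` of the leaf with height `t` over the base point, in the infinite
cyclic covering of a mapping torus whose monodromy lifts to `ψ`. -/
def suspensionHeight (e : E) (t : ℝ) : ℝ := assemble (fun n => fiberHeight P κ ((ψ ^ n) e)) t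

variable {κ}

lemma floor_suspensionHeight (hκ : ∀ g, Monotone (κ g)) (e : E) (t : ℝ) :
    ⌊suspensionHeight P κ ψ e t⌋ = ⌊t⌋ :=
  floor_assemble (fun _ => isUnitMap_fiberHeight P hκ _) t

lemma strictMono_suspensionHeight (hκ : ∀ g, Monotone (κ g)) (e : E) :
    StrictMono (suspensionHeight P κ ψ e) :=
  strictMono_assemble fun _ => isUnitMap_fiberHeight P hκ _

lemma suspensionHeight_eq_on_Ioo (hκ : ∀ g, Monotone (κ g)) (e : E) {n : ℤ} {t : ℝ}
    (ht : t ∈ Ioo ((n : ℝ) - 1) (n + 1)) :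
    suspensionHeight P κ ψ e t = t + (fiberHeight P κ ((ψ ^ n) e) (t - n) - (t - n)) +
      (fiberHeight P κ ((ψ ^ (n - 1)) e) (t - n + 1) - (t - n + 1)) :=
  assemble_eq_on_Ioo (fun _ => isUnitMap_fiberHeight P hκ _) ht

lemma suspensionHeight_eq_on_Icc (hκ : ∀ g, Monotone (κ g)) (e : E) {t : ℝ}
    (ht : t ∈ Icc (0 : ℝ) 1) : suspensionHeight P κ ψ e t = fiberHeight P κ e t := by
  rw [suspensionHeight, assemble_eq_on_Icc (fun _ => isUnitMap_fiberHeight P hκ _) ht, zpow_zero]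
  rfl

lemma suspensionHeight_base (hκ : ∀ g, Monotone (κ g)) {t : ℝ} (ht : t ∈ Icc (0 : ℝ) 1) :
    suspensionHeight P κ ψ e₀ t = t := by
  rw [suspensionHeight_eq_on_Icc P ψ hκ e₀ ht, fiberHeight_base]

lemma suspensionHeight_mem_Icc_iff (hκ : ∀ g, Monotone (κ g)) (e : E) {t : ℝ} :
    suspensionHeight P κ ψ e t ∈ Icc (0 : ℝ) 1 ↔ t ∈ Icc (0 : ℝ) 1 := by
  have isUnitMap := isUnitMap_fiberHeight P hκ e
  have zero : suspensionHeight P κ ψ e 0 = 0 := by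
    rw [suspensionHeight_eq_on_Icc P ψ hκ e (by simp), isUnitMap.eq_of_le 0 le_rfl]
  have one : suspensionHeight P κ ψ e 1 = 1 := by
    rw [suspensionHeight_eq_on_Icc P ψ hκ e (by simp), isUnitMap.eq_of_ge 1 le_rfl]
  have strictMono := strictMono_suspensionHeight P ψ hκ e
  have zero_le_iff := strictMono.le_iff_le (a := 0) (b := t)
  have le_one_iff := strictMono.le_iff_le (a := t) (b := 1)
  rw [zero] at zero_le_iff
  rw [one] at le_one_iff
  rw [mem_Icc, mem_Icc, zero_le_iff, le_one_iff]

lemma continuous_suspensionHeight (hp : Continuous p) (hκ : ∀ g, Monotone (κ g)) :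
    Continuous fun z : E × ℝ => suspensionHeight P κ ψ z.1 z.2 := by
  rw [continuous_iff_continuousAt]
  intro z
  have near : ∀ᶠ w : E × ℝ in 𝓝 z, w.2 ∈ Ioo ((⌊z.2⌋ : ℝ) - 1) (⌊z.2⌋ + 1) :=
    continuous_snd.continuousAt.eventually (isOpen_Ioo.mem_nhds (mem_Ioo_floor z.2))
  refine ContinuousAt.congr ?_
    (near.mono fun w hw => (suspensionHeight_eq_on_Ioo P ψ hκ w.1 hw).symm)
  have continuous_height (k : ℤ) {s : E × ℝ → ℝ} (hs : Continuous s) :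
      Continuous fun w : E × ℝ => fiberHeight P κ ((ψ ^ k) w.1) (s w) :=
    (continuous_fiberHeight P hp hκ).comp
      (((ψ ^ k).continuous.comp continuous_fst).prodMk hs)
  have := continuous_height ⌊z.2⌋ (s := fun w => w.2 - ⌊z.2⌋) (by fun_prop)
  have :=
    continuous_height (⌊z.2⌋ - 1) (s := fun w => w.2 - ⌊z.2⌋ + 1) (by fun_prop)
  fun_prop

lemma surjective_suspensionHeight (hp : Continuous p) (hκ : ∀ g, Monotone (κ g)) (e : E) :
    Function.Surjective (suspensionHeight P κ ψ e) :=
  surjective_of_floor_eq ((continuous_suspensionHeight P ψ hp hκ).comp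
    (by fun_prop : Continuous fun t : ℝ => (e, t))) (floor_suspensionHeight P ψ hκ e)

/-- The homeomorphism of `E × ℝ` that carries the horizontal foliation to the suspension. -/
def suspensionHomeomorph (hp : Continuous p) (hκ : ∀ g, Monotone (κ g)) : E × ℝ ≃ₜ E × ℝ :=
  fiberwiseHomeomorph (suspensionHeight P κ ψ) (continuous_suspensionHeight P ψ hp hκ)
    (strictMono_suspensionHeight P ψ hκ) (surjective_suspensionHeight P ψ hp hκ)

lemma suspensionHeight_zpow (e : E) (t : ℝ) (n : ℤ) :
    suspensionHeight P κ ψ ((ψ ^ n) e) (t - n) = suspensionHeight P κ ψ e t - n := by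
  rw [suspensionHeight, suspensionHeight, ← assemble_sub_int]
  congr 1
  funext k
  rw [zpow_add]
  rfl

end Heights

section DeckHeight

variable {G : Type*} [Group G] {κ : G →* (I ≃ₜ I)} (hκ : ∀ g, Monotone (κ g)) (c : ℤ → G →* G)

/-- The effect on the heights of a deck transformation `g` of the covering of the fibre, where `c n`
is the conjugation by the `n`-th power of a lift of the monodromy. -/
def deckHeight (g : G) : ℝ ≃ₜ ℝ := assembleHomeomorph (fun n => κ (c n g)) fun _ => hκ _

lemma floor_deckHeight (g : G) (t : ℝ) : ⌊deckHeight hκ c g t⌋ = ⌊t⌋ :=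
  floor_assembleHomeomorph _ t

variable {c}

lemma deckHeight_coe (hc : c 0 = MonoidHom.id G) (g : G) (t : I) :
    deckHeight hκ c g t = κ g t := by
  rw [deckHeight, assembleHomeomorph_coe, hc, MonoidHom.id_apply]

lemma eq_one_of_eventually_deckHeight_eq (generic : IsGeneric κ)
    (hc : ∀ n, Function.Injective (c n)) {g : G} {t : ℝ}
    (fixed : ∀ᶠ s in 𝓝 t, deckHeight hκ c g s = s) : g = 1 := by
  obtain ⟨θ, pos, lt_one, fixed_θ⟩ := eventually_fixed_of_assembleHomeomorph _ fixed
  by_contra ne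
  have c_ne : c ⌊t⌋ g ≠ 1 := fun h => ne ((map_eq_one_iff _ (hc _)).1 h)
  have isolated := generic _ c_ne θ pos lt_one fixed_θ.self_of_nhds
  obtain ⟨θ', moved, fixed'⟩ := (isolated.and (fixed_θ.filter_mono nhdsWithin_le_nhds)).exists
  exact moved fixed'

lemma suspensionHeight_smul {S E ι : Type*} [TopologicalSpace S] [TopologicalSpace E]
    [MulAction G E] [Fintype ι] {p : E → S} {e₀ : E} (P : SheetPartition G p e₀ ι) {ψ : E ≃ₜ E}
    (hp : IsQuotientCoveringMap p G) (hc : ∀ n g e, (ψ ^ n) (g • e) = c n g • (ψ ^ n) e) (g : G)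
    (e : E) (t : ℝ) :
    suspensionHeight P κ ψ (g • e) (deckHeight hκ c g t) = suspensionHeight P κ ψ e t := by
  rw [suspensionHeight, deckHeight, assembleHomeomorph_apply,
    ← assemble_comp (fun n => isUnitMap_unitExtension (hκ (c n g)))]
  simp only [hc, fiberHeight_smul P hp hκ]
  rfl

end DeckHeight

/-! ## Suspensions in mapping tori -/

lemma isLocalHomeomorph_prodMap_id {X Y Z : Type*} [TopologicalSpace X] [TopologicalSpace Y]
    [TopologicalSpace Z] {f : X → Y} (hf : IsLocalHomeomorph f) :
    IsLocalHomeomorph (Prod.map f (id : Z → Z)) := by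
  intro z
  obtain ⟨Φ, hz, rfl⟩ := hf z.1
  exact ⟨Φ.prod (OpenPartialHomeomorph.refl Z), ⟨hz, mem_univ _⟩, rfl⟩

section Suspension

variable {S N E G ι : Type*} [TopologicalSpace S] [ChartedSpace (EuclideanHalfSpace 2) S]
  [TopologicalSpace N] [ChartedSpace HalfSpaceProd N] [TopologicalSpace E] [Group G]
  [MulAction G E] [Fintype ι] {p : E → S} {e₀ : E}

/-- The map from `E × ℝ` to the mapping torus that carries the horizontal foliation to the
suspension of `κ`. -/
def developingMap (P : SheetPartition G p e₀ ι) (κ : G →* (I ≃ₜ I)) (ψ : E ≃ₜ E) (q : S × ℝ → N)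
    (z : E × ℝ) : N :=
  q (p z.1, suspensionHeight P κ ψ z.1 z.2)

/-- The deck transformation of the developing map that consists of the `n`-th power of the lift `ψ`
of the monodromy, followed by the deck transformation `g` of the covering of the fibre. -/
def suspensionDeck [ContinuousConstSMul G E] {κ : G →* (I ≃ₜ I)} (hκ : ∀ g, Monotone (κ g))
    (c : ℤ → G →* G) (ψ : E ≃ₜ E) (g : G) (n : ℤ) : (E ≃ₜ E) × (ℝ ≃ₜ ℝ) :=
  (Homeomorph.smul g * ψ ^ n, deckHeight hκ c g * Homeomorph.subRight (n : ℝ))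

variable (P : SheetPartition G p e₀ ι) {κ : G →* (I ≃ₜ I)} {ψ : E ≃ₜ E} {c : ℤ → G →* G}
  {φ : S ≃ₘ^∞⟮𝓡∂ 2, 𝓡∂ 2⟯ S} {q : S × ℝ → N}
  (hp : IsQuotientCoveringMap p G) (hκ : ∀ g, Monotone (κ g))
  (hψ : ∀ e, p (ψ e) = φ (p e)) (hc : ∀ n g e, (ψ ^ n) (g • e) = c n g • (ψ ^ n) e)
  (hq : IsMappingTorus φ q)

omit [TopologicalSpace N] [ChartedSpace HalfSpaceProd N] [ChartedSpace (EuclideanHalfSpace 2) S] in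
include hp hc in
lemma suspensionHeight_suspensionDeck [ContinuousConstSMul G E] (g : G) (n : ℤ) (e : E) (t : ℝ) :
    suspensionHeight P κ ψ ((suspensionDeck hκ c ψ g n).1 e) ((suspensionDeck hκ c ψ g n).2 t) =
      suspensionHeight P κ ψ e t - n :=
  (suspensionHeight_smul hκ P hp hc g _ _).trans (suspensionHeight_zpow P ψ e t n)

include hp hψ in
lemma proj_suspensionDeck [ContinuousConstSMul G E] (g : G) (n : ℤ) (e : E) :
    p ((suspensionDeck hκ c ψ g n).1 e) = ((φ.toEquiv : Equiv.Perm S) ^ n) (p e) :=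
  (hp.map_smul g).trans (proj_zpow (χ := φ.toEquiv) hψ n e)

include hp hψ hc hq in
lemma suspensionDeck_mem_deckGroup [ContinuousConstSMul G E] (g : G) (n : ℤ) :
    suspensionDeck hκ c ψ g n ∈ deckGroup (developingMap P κ ψ q) := fun e t =>
  ((hq.eq_iff _ _ _ _).2 ⟨n, proj_suspensionDeck hp hκ hψ g n e,
    suspensionHeight_suspensionDeck P hp hκ hc g n e t⟩).symm

include hp hψ hc hq in
lemma exists_suspensionDeck_of_eq [ContinuousConstSMul G E] {e e' : E} {t t' : ℝ}
    (h : developingMap P κ ψ q (e, t) = developingMap P κ ψ q (e', t')) :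
    ∃ g n, (suspensionDeck hκ c ψ g n).1 e = e' ∧ (suspensionDeck hκ c ψ g n).2 t = t' := by
  obtain ⟨n, proj_eq, height_eq⟩ := (hq.eq_iff _ _ _ _).1 h
  rw [← proj_zpow (χ := φ.toEquiv) hψ] at proj_eq
  obtain ⟨g, rfl⟩ := exists_smul_eq_of_proj_eq hp proj_eq.symm
  exact ⟨g, n, rfl, (strictMono_suspensionHeight P ψ hκ _).injective
    ((suspensionHeight_suspensionDeck P hp hκ hc g n e t).trans height_eq.symm)⟩

include hp hψ hc hq hκ in
lemma isFoliatedCover_developingMap : IsFoliatedCover (developingMap P κ ψ q) where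
  surjective y := by
    obtain ⟨⟨x, r⟩, rfl⟩ := hq.surjective y
    obtain ⟨e, rfl⟩ := hp.surjective x
    obtain ⟨t, rfl⟩ := surjective_suspensionHeight P ψ hp.isCoveringMap.continuous hκ e r
    exact ⟨(e, t), rfl⟩
  isLocalHomeomorph := hq.localDiffeo.isLocalHomeomorph.comp
    ((isLocalHomeomorph_prodMap_id hp.isCoveringMap.isLocalHomeomorph).comp
      (suspensionHomeomorph P ψ hp.isCoveringMap.continuous hκ).isLocalHomeomorph)
  exists_deck h := by
    have := hp.toContinuousConstSMul
    obtain ⟨g, n, deck_eq⟩ := exists_suspensionDeck_of_eq P hp hκ hψ hc hq h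
    exact ⟨_, suspensionDeck_mem_deckGroup P hp hκ hψ hc hq g n, deck_eq⟩

include hp hψ hc hq in
lemma exists_eq_suspensionDeck [ContinuousConstSMul G E] [T2Space E] [PreconnectedSpace E]
    {d : (E ≃ₜ E) × (ℝ ≃ₜ ℝ)} (hd : d ∈ deckGroup (developingMap P κ ψ q)) :
    ∃ g n, d = suspensionDeck hκ c ψ g n := by
  obtain ⟨g, n, he, ht⟩ := exists_suspensionDeck_of_eq P hp hκ hψ hc hq (hd e₀ 0).symm
  refine ⟨g, n, inv_mul_eq_one.1 ((isFoliatedCover_developingMap P hp hκ hψ hc hq).deck_eq_one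
    (mul_mem (inv_mem hd) (suspensionDeck_mem_deckGroup P hp hκ hψ hc hq g n)) (e := e₀) (t := 0)
    ?_ ?_)⟩
  · exact (congrArg (d⁻¹).1 he).trans (d.1.symm_apply_apply e₀)
  · exact (congrArg (d⁻¹).2 ht).trans (d.2.symm_apply_apply 0)

include hp hκ hψ hc hq in
lemma hasFaithfulHolonomy_developingMap [T2Space E] [PreconnectedSpace E] (generic : IsGeneric κ) :
    HasFaithfulHolonomy (developingMap P κ ψ q) := by
  have := hp.toContinuousConstSMul
  intro d hd t fixed
  obtain ⟨g, n, rfl⟩ := exists_eq_suspensionDeck P hp hκ hψ hc hq hd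
  have height_eq (s : ℝ) : (suspensionDeck hκ c ψ g n).2 s = deckHeight hκ c g (s - n) := rfl
  obtain rfl : n = 0 := by
    have floor_eq := congrArg Int.floor fixed.self_of_nhds
    rw [height_eq, floor_deckHeight, Int.floor_sub_intCast] at floor_eq
    omega
  have injective (n : ℤ) : Function.Injective (c n) :=
    have : Nonempty E := ⟨e₀⟩
    injective_of_smul_eq hp (ψ ^ n).injective (hc n)
  obtain rfl : g = 1 := by
    simp only [height_eq, Int.cast_zero, sub_zero] at fixed
    exact eq_one_of_eventually_deckHeight_eq hκ generic injective fixed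
  refine (isFoliatedCover_developingMap P hp hκ hψ hc hq).deck_eq_one hd (e := e₀) (t := t) ?_
    fixed.self_of_nhds
  exact one_smul G e₀

section Holonomy

variable {𝒞 : Set (OpenPartialHomeomorph E (EuclideanHalfSpace 2))}
  (h𝒞 : ∀ e, ∃ C ∈ 𝒞, e ∈ C.source) (hQ : IsFoliatedCover (developingMap P κ ψ q))

omit [ChartedSpace (EuclideanHalfSpace 2) S]
  [ChartedSpace HalfSpaceProd N] in
include hp hκ in
lemma exists_height_of_isLeafwise (L : C(I, E)) (u : C(I, I))
    (leafwise : (hQ.foliation h𝒞).IsLeafwise fun s => q (p (L s), (u s : ℝ))) :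
    ∃ t, ∀ s, (u s : ℝ) = suspensionHeight P κ ψ (L s) t := by
  let Ψ := suspensionHomeomorph P ψ hp.isCoveringMap.continuous hκ
  have height_eq (s : I) : suspensionHeight P κ ψ (L s) (Ψ.symm (L s, u s)).2 = u s :=
    congrArg Prod.snd (Ψ.apply_symm_apply (L s, (u s : ℝ)))
  have continuous_height : Continuous fun s => (Ψ.symm (L s, (u s : ℝ))).2 := by fun_prop
  have leafwise_developingMap : (hQ.foliation h𝒞).IsLeafwise fun s =>
      developingMap P κ ψ q (L s, (Ψ.symm (L s, (u s : ℝ))).2) := by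
    simpa only [developingMap, height_eq] using leafwise
  refine ⟨(Ψ.symm (L 0, (u 0 : ℝ))).2, fun s => ?_⟩
  rw [← hQ.height_eq_of_isLeafwise h𝒞 L.continuous continuous_height leafwise_developingMap s 0,
    height_eq]

omit [ChartedSpace (EuclideanHalfSpace 2) S]
  [ChartedSpace HalfSpaceProd N] in
include hp hκ in
lemma existsUnique_leafwise_lift (γ : C(I, S)) (θ : I) : ∃! u : C(I, I),
    u 0 = θ ∧ (hQ.foliation h𝒞).IsLeafwise (fun s => q (γ s, (u s : ℝ))) := by
  have continuous_proj := hp.isCoveringMap.continuous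
  obtain ⟨e, he⟩ := hp.surjective (γ 0)
  obtain ⟨L, lift, -⟩ := hp.isCoveringMap.exists_path_lifts γ e he.symm
  have proj_lift (s : I) : p (L s) = γ s := congrFun lift s
  obtain ⟨t, ht⟩ := surjective_suspensionHeight P ψ continuous_proj hκ (L 0) θ
  have mem_Icc (s : I) : suspensionHeight P κ ψ (L s) t ∈ I :=
    (suspensionHeight_mem_Icc_iff P ψ hκ _).2
      ((suspensionHeight_mem_Icc_iff P ψ hκ (L 0)).1 (ht ▸ θ.2))
  have continuous_height : Continuous fun s => suspensionHeight P κ ψ (L s) t :=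
    (continuous_suspensionHeight P ψ continuous_proj hκ).comp
      (by fun_prop : Continuous fun s => (L s, t))
  refine ⟨⟨fun s => ⟨_, mem_Icc s⟩, continuous_height.subtype_mk _⟩, ⟨Subtype.ext ht, ?_⟩, ?_⟩
  · simpa only [developingMap, proj_lift, ContinuousMap.coe_mk] using
      hQ.isLeafwise h𝒞 t L.continuous
  · rintro u ⟨hu₀, leafwise⟩
    obtain ⟨t', ht'⟩ := exists_height_of_isLeafwise P hp hκ h𝒞 hQ L u
      (by simpa only [proj_lift] using leafwise)
    obtain rfl : t' = t := (strictMono_suspensionHeight P ψ hκ (L 0)).injective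
      (by rw [← ht', hu₀, ht])
    exact ContinuousMap.ext fun s => Subtype.ext (ht' s)

omit [ChartedSpace (EuclideanHalfSpace 2) S] in
include hp hκ hc in
lemma suspensionHeight_smul_base (g : G) (θ : I) :
    suspensionHeight P κ ψ (g • e₀) θ = κ g⁻¹ θ := by
  have c_zero : c 0 = MonoidHom.id G :=
    MonoidHom.ext fun g => eq_of_smul_eq_smul hp (e := e₀) (hc 0 g e₀).symm
  have height_eq : deckHeight hκ c g (κ g⁻¹ θ : I) = θ := by
    rw [deckHeight_coe hκ c_zero, map_inv]
    exact congrArg Subtype.val ((κ g).apply_symm_apply θ)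
  rw [← height_eq, suspensionHeight_smul hκ P hp hc, suspensionHeight_base P ψ hκ (κ g⁻¹ θ).2]

omit [ChartedSpace (EuclideanHalfSpace 2) S] [ChartedSpace HalfSpaceProd N] in
include hp hκ hc in
lemma isSuspension_foliation [SimplyConnectedSpace E] :
    (hQ.foliation h𝒞).IsSuspension q (κ.comp (fundamentalGroupEquivDeck hp e₀).toMonoidHom) where
  existsUnique_lift := existsUnique_leafwise_lift P hp hκ h𝒞 hQ
  holonomy γ u leafwise := by
    obtain ⟨L, lift, hL₀⟩ := hp.isCoveringMap.exists_path_lifts γ.toContinuousMap e₀ γ.source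
    have proj_lift (s : I) : p (L s) = γ s := congrFun lift s
    obtain ⟨t, ht⟩ := exists_height_of_isLeafwise P hp hκ h𝒞 hQ L u
      (by simpa only [proj_lift] using leafwise)
    have mem_Icc : t ∈ Icc (0 : ℝ) 1 :=
      (suspensionHeight_mem_Icc_iff P ψ hκ (L 0)).1 (ht 0 ▸ (u 0).2)
    obtain rfl : (u 0 : ℝ) = t := by rw [ht, hL₀, suspensionHeight_base P ψ hκ mem_Icc]
    obtain ⟨g, hg⟩ := exists_smul_eq_of_proj_eq hp (e := e₀) (e' := L 1)
      (by rw [proj_lift, γ.target])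
    change u 1 = κ (fundamentalGroupEquivDeck hp e₀ _) (u 0)
    rw [fundamentalGroupEquivDeck_fromPath hp hL₀ proj_lift hg.symm]
    exact Subtype.ext (by rw [ht, ← hg, suspensionHeight_smul_base P hp hκ hc])

end Holonomy

end Suspension

/-! ## Smoothness of the heights -/

section Flat

variable {F : Type*} [NormedAddCommGroup F] [NormedSpace ℝ F] {f : ℝ → F} {a b : ℝ}

lemma indicator_derivWithin_eq_zero (flat_left : derivWithin f (Icc a b) a = 0)
    (flat_right : derivWithin f (Icc a b) b = 0) {t : ℝ} (ht : t ∉ Ioo a b) :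
    (Icc a b).indicator (derivWithin f (Icc a b)) t = 0 := by
  rw [indicator_apply_eq_zero]
  intro mem_Icc
  rcases eq_endpoints_or_mem_Ioo_of_mem_Icc mem_Icc with rfl | rfl | mem_Ioo
  · exact flat_left
  · exact flat_right
  · exact absurd mem_Ioo ht

lemma hasDerivAt_of_flat (hf : DifferentiableOn ℝ f (Icc a b)) (vanish : ∀ t ∉ Ioo a b, f t = 0)
    (flat_left : derivWithin f (Icc a b) a = 0) (flat_right : derivWithin f (Icc a b) b = 0)
    (t : ℝ) : HasDerivAt f ((Icc a b).indicator (derivWithin f (Icc a b)) t) t := by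
  have hasDerivWithinAt_of_vanish {s : Set ℝ} (closed : IsClosed s) (hs : ∀ r ∈ s, r ∉ Ioo a b) :
      HasDerivWithinAt f ((Icc a b).indicator (derivWithin f (Icc a b)) t) s t := by
    by_cases ht : t ∈ s
    · rw [indicator_derivWithin_eq_zero flat_left flat_right (hs t ht)]
      exact (hasDerivWithinAt_const t s 0).congr (fun r hr => vanish r (hs r hr))
        (vanish t (hs t ht))
    · exact HasFDerivWithinAt.of_notMem_closure (by rwa [closed.closure_eq])
  have hasDerivWithinAt_Icc :
      HasDerivWithinAt f ((Icc a b).indicator (derivWithin f (Icc a b)) t) (Icc a b) t := by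
    by_cases ht : t ∈ Icc a b
    · rw [indicator_of_mem ht]
      exact (hf t ht).hasDerivWithinAt
    · exact HasFDerivWithinAt.of_notMem_closure (by rwa [isClosed_Icc.closure_eq])
  rw [← hasDerivWithinAt_univ]
  refine ((hasDerivWithinAt_of_vanish (s := Iic a) isClosed_Iic fun r hr h => h.1.not_ge hr).union
    (hasDerivWithinAt_Icc.union (hasDerivWithinAt_of_vanish (s := Ici b) isClosed_Ici
      fun r hr h => h.2.not_ge hr))).mono fun r _ => ?_
  by_cases le_left : r ≤ a
  · exact Or.inl le_left
  · exact Or.inr ((le_total r b).imp (fun le_right => ⟨(not_le.1 le_left).le, le_right⟩) id)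

lemma contDiff_of_flat (hab : a < b) (hf : ContDiffOn ℝ ∞ f (Icc a b))
    (vanish : ∀ t ∉ Ioo a b, f t = 0) (flat_left : ∀ n, iteratedDerivWithin n f (Icc a b) a = 0)
    (flat_right : ∀ n, iteratedDerivWithin n f (Icc a b) b = 0) : ContDiff ℝ ∞ f := by
  refine contDiff_infty.2 fun n => ?_
  induction n generalizing f with
  | zero =>
    refine contDiff_zero.2 (continuous_iff_continuousAt.2 fun t =>
      (hasDerivAt_of_flat (hf.differentiableOn (by simp)) vanish ?_ ?_ t).continuousAt)
    · rw [← iteratedDerivWithin_one, flat_left]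
    · rw [← iteratedDerivWithin_one, flat_right]
  | succ n ih =>
    have deriv_left : derivWithin f (Icc a b) a = 0 := by rw [← iteratedDerivWithin_one, flat_left]
    have deriv_right : derivWithin f (Icc a b) b = 0 := by
      rw [← iteratedDerivWithin_one, flat_right]
    have hasDerivAt := hasDerivAt_of_flat (hf.differentiableOn (by simp)) vanish
      deriv_left deriv_right
    have eqOn : EqOn ((Icc a b).indicator (derivWithin f (Icc a b))) (derivWithin f (Icc a b))
        (Icc a b) := fun t ht => indicator_of_mem ht _
    have iteratedDerivWithin_deriv (n : ℕ) {t : ℝ} (ht : t ∈ Icc a b) :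
        iteratedDerivWithin n ((Icc a b).indicator (derivWithin f (Icc a b))) (Icc a b) t =
          iteratedDerivWithin (n + 1) f (Icc a b) t := by
      rw [iteratedDerivWithin_congr eqOn ht, iteratedDerivWithin_succ']
    push_cast
    rw [contDiff_succ_iff_deriv, funext fun t => (hasDerivAt t).deriv]
    refine ⟨fun t => (hasDerivAt t).differentiableAt, by simp, ih ?_ ?_ ?_ ?_⟩
    · exact (hf.derivWithin (uniqueDiffOn_Icc hab) (by norm_cast)).congr eqOn
    · exact fun t => indicator_derivWithin_eq_zero deriv_left deriv_right
    · exact fun n => by rw [iteratedDerivWithin_deriv n (left_mem_Icc.2 hab.le), flat_left]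
    · exact fun n => by rw [iteratedDerivWithin_deriv n (right_mem_Icc.2 hab.le), flat_right]

end Flat

section Tapered

variable {g : I ≃ₜ I}

lemma contDiff_unitExtension (hg : Monotone g) (tapered : IsTaperedDiffeo g) :
    ContDiff ℝ ∞ (unitExtension g) := by
  have eqOn : EqOn (displacement g) (fun t => realExtension g t - t) (Icc 0 1) := fun t ht => by
    simp only [displacement, realExtension, projIcc_of_mem _ ht]
  refine contDiff_id.add (contDiff_of_flat zero_lt_one
    ((tapered.smooth.sub contDiffOn_id).congr eqOn) (fun t ht => ?_) (fun n => ?_) (fun n => ?_))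
  · rcases le_or_gt t 0 with le_zero | pos
    · exact displacement_of_le hg le_zero
    · exact displacement_of_ge hg (not_lt.1 fun lt_one => ht ⟨pos, lt_one⟩)
  · rw [iteratedDerivWithin_congr eqOn (by simp), tapered.tangent_zero]
  · rw [iteratedDerivWithin_congr eqOn (by simp), tapered.tangent_one]

lemma differentiable_unitExtension (hg : Monotone g) (tapered : IsTaperedDiffeo g) :
    Differentiable ℝ (unitExtension g) :=
  (contDiff_unitExtension hg tapered).differentiable (by simp)

lemma deriv_unitExtension_pos (hg : Monotone g) (hg' : Monotone ⇑g⁻¹) (tapered : IsTaperedDiffeo g)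
    (tapered_inv : IsTaperedDiffeo g⁻¹) (t : ℝ) : 0 < deriv (unitExtension g) t := by
  have left_inverse : unitExtension g⁻¹ ∘ unitExtension g = id := by
    funext s
    rw [Function.comp_apply, ← unitExtension_mul hg' hg, inv_mul_cancel, unitExtension_one, id]
  have chain := ((differentiable_unitExtension hg' tapered_inv _).hasDerivAt.comp t
    (differentiable_unitExtension hg tapered t).hasDerivAt).deriv
  rw [left_inverse, deriv_id] at chain
  exact (isUnitMap_unitExtension hg).strictMono.monotone.deriv_nonneg.lt_of_ne'
    (right_ne_zero_of_mul (chain ▸ one_ne_zero))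

lemma deriv_unitExtension_of_ge (hg : Monotone g) (tapered : IsTaperedDiffeo g) {t : ℝ}
    (ht : 1 ≤ t) : deriv (unitExtension g) t = 1 := by
  have hasDerivWithinAt : HasDerivWithinAt (unitExtension g) 1 (Ici 1) t :=
    (hasDerivWithinAt_id t _).congr (fun s hs => (isUnitMap_unitExtension hg).eq_of_ge s hs)
      ((isUnitMap_unitExtension hg).eq_of_ge t ht)
  exact (uniqueDiffOn_Ici 1 t ht).eq_deriv _
    (differentiable_unitExtension hg tapered t).hasDerivAt.hasDerivWithinAt hasDerivWithinAt

end Tapered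

section Implicit

variable {V : Type*} [NormedAddCommGroup V] [NormedSpace ℝ V]

/-- The linear automorphism `(v, s) ↦ (v, L (v, s))` of `V × ℝ`. -/
def fiberwiseLinearEquiv (L : V × ℝ →L[ℝ] ℝ) (hL : L (0, 1) ≠ 0) : (V × ℝ) ≃L[ℝ] V × ℝ :=
  have split (v : V) (s : ℝ) : L (v, s) = L (v, 0) + s * L (0, 1) := by
    rw [← smul_eq_mul, ← map_smul, ← map_add]
    simp
  ContinuousLinearEquiv.equivOfInverse ((ContinuousLinearMap.fst ℝ V ℝ).prod L)
    ((ContinuousLinearMap.fst ℝ V ℝ).prod ((L (0, 1))⁻¹ • (ContinuousLinearMap.snd ℝ V ℝ -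
      L.comp ((ContinuousLinearMap.inl ℝ V ℝ).comp (ContinuousLinearMap.fst ℝ V ℝ)))))
    (fun ⟨v, s⟩ => Prod.ext rfl (by simp [split v s, mul_comm s, hL]))
    (fun ⟨v, s⟩ => Prod.ext rfl (by simp [split v (_ * _), mul_comm _ (L (0, 1)), hL]))

lemma exists_contDiffAt_inverse [CompleteSpace V] {H : V × ℝ → ℝ} {v : V} {t a : ℝ}
    (hH : ContDiffAt ℝ ∞ H (v, t)) (ha : HasDerivAt (fun s => H (v, s)) a t) (ha₀ : a ≠ 0) :
    ∃ K : V × ℝ → ℝ, ContDiffAt ℝ ∞ K (v, H (v, t)) ∧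
      ∀ᶠ z in 𝓝 (v, t), K (z.1, H z) = z.2 := by
  have hasFDerivAt := (hH.differentiableAt (by simp)).hasFDerivAt
  have fderiv_apply : fderiv ℝ H (v, t) (0, 1) = a :=
    (hasFDerivAt.comp_hasDerivAt t ((hasDerivAt_const t v).prodMk (hasDerivAt_id t))).unique ha
  have contDiffAt_map : ContDiffAt ℝ ∞ (fun z : V × ℝ => (z.1, H z)) (v, t) :=
    contDiffAt_fst.prodMk hH
  have hasFDerivAt_map : HasFDerivAt (fun z : V × ℝ => (z.1, H z))
      (fiberwiseLinearEquiv (fderiv ℝ H (v, t)) (fderiv_apply ▸ ha₀) : V × ℝ →L[ℝ] V × ℝ) (v, t) :=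
    hasFDerivAt_fst.prodMk hasFDerivAt
  exact ⟨fun z => (contDiffAt_map.localInverse hasFDerivAt_map (by simp) z).2,
    (contDiffAt_map.to_localInverse hasFDerivAt_map (by simp)).snd,
    (contDiffAt_map.hasStrictFDerivAt' hasFDerivAt_map (by simp)).eventually_left_inverse.mono
      fun z hz => congrArg Prod.snd hz⟩

end Implicit

section LocalFormula

variable {G ι : Type*} [Group G] [Fintype ι] {κ : G →* (I ≃ₜ I)}

/-- The height of a leaf of the suspension near height `n`, as a function of the weights `z.1.1` and
`z.1.2` of the partition of unity at the two relevant iterates of the point; on a small open set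
the sheets `g` and `g'` of the partition are constant. -/
def localHeight (κ : G →* (I ≃ₜ I)) (g g' : ι → G) (n : ℤ) (z : ((ι → ℝ) × (ι → ℝ)) × ℝ) : ℝ :=
  z.2 + (∑ i, z.1.1 i * unitExtension (κ (g i)) (z.2 - n) - (z.2 - n)) +
    (∑ i, z.1.2 i * unitExtension (κ (g' i)) (z.2 - n + 1) - (z.2 - n + 1))

variable (hκ : ∀ g, Monotone (κ g)) (tapered : ∀ g, IsTaperedDiffeo (κ g))
include hκ tapered

lemma contDiff_localHeight (g g' : ι → G) (n : ℤ) : ContDiff ℝ ∞ (localHeight κ g g' n) := by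
  have contDiff_upper (i : ι) := contDiff_unitExtension (hκ (g i)) (tapered (g i))
  have contDiff_lower (i : ι) := contDiff_unitExtension (hκ (g' i)) (tapered (g' i))
  unfold localHeight
  fun_prop

lemma hasDerivAt_sum_unitExtension (g : ι → G) (w : ι → ℝ) {f : ℝ → ℝ} {t : ℝ}
    (hf : HasDerivAt f 1 t) :
    HasDerivAt (fun s => ∑ i, w i * unitExtension (κ (g i)) (f s))
      (∑ i, w i * deriv (unitExtension (κ (g i))) (f t)) t :=
  HasDerivAt.fun_sum fun i _ => by
    simpa using ((differentiable_unitExtension (hκ (g i)) (tapered (g i)) (f t)).hasDerivAt.comp t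
      hf).const_mul (w i)

lemma exists_hasDerivAt_localHeight (g g' : ι → G) {n : ℤ} {w w' : ι → ℝ} {t : ℝ} (ht : n ≤ t)
    (nonneg : ∀ i, 0 ≤ w i) (sum_w : ∑ i, w i = 1) (sum_w' : ∑ i, w' i = 1) :
    ∃ a ≠ 0, HasDerivAt (fun s => localHeight κ g g' n ((w, w'), s)) a t := by
  have hasDerivAt_sub : HasDerivAt (fun s : ℝ => s - n) 1 t := (hasDerivAt_id t).sub_const _
  have hasDerivAt_sub_add : HasDerivAt (fun s : ℝ => s - n + 1) 1 t := hasDerivAt_sub.add_const _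
  have lower_deriv : ∑ i, w' i * deriv (unitExtension (κ (g' i))) (t - n + 1) = 1 := by
    refine (Finset.sum_congr rfl fun i _ => ?_).trans sum_w'
    rw [deriv_unitExtension_of_ge (hκ _) (tapered _) (by linarith), mul_one]
  have upper_deriv_pos : 0 < ∑ i, w i * deriv (unitExtension (κ (g i))) (t - n) := by
    have deriv_pos (i : ι) : 0 < deriv (unitExtension (κ (g i))) (t - n) :=
      deriv_unitExtension_pos (hκ _) (map_inv κ (g i) ▸ hκ _) (tapered _)
        (map_inv κ (g i) ▸ tapered _) _
    obtain ⟨j, hj⟩ : ∃ j, 0 < w j := by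
      by_contra! nonpos
      linarith [Finset.sum_nonpos fun i (_ : i ∈ Finset.univ) => nonpos i]
    exact Finset.sum_pos' (fun i _ => mul_nonneg (nonneg i) (deriv_pos i).le)
      ⟨j, Finset.mem_univ j, mul_pos hj (deriv_pos j)⟩
  refine ⟨_, ?_, ((hasDerivAt_id t).add ((hasDerivAt_sum_unitExtension hκ tapered g w
    hasDerivAt_sub).sub hasDerivAt_sub)).add ((hasDerivAt_sum_unitExtension hκ tapered g' w'
    hasDerivAt_sub_add).sub hasDerivAt_sub_add)⟩
  rw [lower_deriv]
  linarith

end LocalFormula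

section HalfSpaceProd

/- `HalfSpaceProd` carries the charted space structure of a model space, whereas the projections of
a product of manifolds are known to be smooth for the product structure. -/

lemma contMDiffAt_prodMk_halfSpaceProd {V H M : Type*} [NormedAddCommGroup V] [NormedSpace ℝ V]
    [TopologicalSpace H] {J : ModelWithCorners ℝ V H} [TopologicalSpace M] [ChartedSpace H M]
    {f : M → EuclideanHalfSpace 2} {g : M → ℝ} {x : M} (hf : ContMDiffAt J (𝓡∂ 2) ∞ f x)
    (hg : ContMDiffAt J 𝓘(ℝ, ℝ) ∞ g x) :
    ContMDiffAt (M' := HalfSpaceProd) J ((𝓡∂ 2).prod 𝓘(ℝ, ℝ)) ∞ (fun y => (f y, g y)) x := by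
  have contMDiffAt_pair := hf.prodMk hg
  rwa [chartedSpaceSelf_prod] at contMDiffAt_pair

lemma contMDiffAt_fst_halfSpaceProd {z : HalfSpaceProd} :
    ContMDiffAt ((𝓡∂ 2).prod 𝓘(ℝ, ℝ)) (𝓡∂ 2) ∞ (fun w : HalfSpaceProd => w.1) z := by
  have contMDiffAt_proj : ContMDiffAt ((𝓡∂ 2).prod 𝓘(ℝ, ℝ)) (𝓡∂ 2) ∞
      (@Prod.fst (EuclideanHalfSpace 2) ℝ) z := contMDiffAt_fst
  rwa [chartedSpaceSelf_prod] at contMDiffAt_proj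

lemma contMDiffAt_snd_halfSpaceProd {z : HalfSpaceProd} :
    ContMDiffAt ((𝓡∂ 2).prod 𝓘(ℝ, ℝ)) 𝓘(ℝ, ℝ) ∞ (fun w : HalfSpaceProd => w.2) z := by
  have contMDiffAt_proj : ContMDiffAt ((𝓡∂ 2).prod 𝓘(ℝ, ℝ)) 𝓘(ℝ, ℝ) ∞
      (@Prod.snd (EuclideanHalfSpace 2) ℝ) z := contMDiffAt_snd
  rwa [chartedSpaceSelf_prod] at contMDiffAt_proj

end HalfSpaceProd

/-- The charts of a covering space lifted from the base. -/
def liftedCharts {S E : Type*} [TopologicalSpace S] [ChartedSpace (EuclideanHalfSpace 2) S]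
    [TopologicalSpace E] (p : E → S) : Set (OpenPartialHomeomorph E (EuclideanHalfSpace 2)) :=
  {C | ∃ Θ : OpenPartialHomeomorph E S, EqOn Θ p Θ.source ∧
    ∃ D ∈ atlas (EuclideanHalfSpace 2) S, C = Θ.trans D}

lemma exists_mem_liftedCharts {S E : Type*} [TopologicalSpace S]
    [ChartedSpace (EuclideanHalfSpace 2) S] [TopologicalSpace E] {p : E → S}
    (hp : IsLocalHomeomorph p) (e : E) : ∃ C ∈ liftedCharts p, e ∈ C.source := by
  obtain ⟨Θ, hΘ, rfl⟩ := hp e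
  exact ⟨_, ⟨Θ, fun _ _ => rfl, _, chart_mem_atlas _ (Θ e), rfl⟩, by simp [hΘ]⟩

lemma contMDiff_zpow {V H M : Type*} [NormedAddCommGroup V] [NormedSpace ℝ V] [TopologicalSpace H]
    {J : ModelWithCorners ℝ V H} [TopologicalSpace M] [ChartedSpace H M] {r : ℕ∞ω}
    (φ : M ≃ₘ^r⟮J, J⟯ M) (n : ℤ) : ContMDiff J J r ((φ.toEquiv : Equiv.Perm M) ^ n) := by
  induction n using Int.induction_on with
  | zero => exact contMDiff_id
  | succ n ih =>
    rw [zpow_add_one]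
    exact ih.comp φ.contMDiff
  | pred n ih =>
    rw [zpow_sub_one]
    exact ih.comp φ.symm.contMDiff

section SmoothSuspension

variable {S E G ι : Type*} [TopologicalSpace S] [ChartedSpace (EuclideanHalfSpace 2) S]
  [TopologicalSpace E] [Group G] [MulAction G E] [Fintype ι] {p : E → S} {e₀ : E}

/-- The weights that enter the heights of the leaves near height `n`. -/
def heightWeights (P : SheetPartition G p e₀ ι) (φ : S ≃ₘ^∞⟮𝓡∂ 2, 𝓡∂ 2⟯ S) (n : ℤ) (x : S) :
    (ι → ℝ) × (ι → ℝ) :=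
  (fun i => P.weight i (((φ.toEquiv : Equiv.Perm S) ^ n) x),
    fun i => P.weight i (((φ.toEquiv : Equiv.Perm S) ^ (n - 1)) x))

variable {P : SheetPartition G p e₀ ι} {κ : G →* (I ≃ₜ I)} {ψ : E ≃ₜ E}
  {φ : S ≃ₘ^∞⟮𝓡∂ 2, 𝓡∂ 2⟯ S}

lemma contMDiff_heightWeights (hP : ∀ i, ContMDiff (𝓡∂ 2) 𝓘(ℝ, ℝ) ∞ (P.weight i)) (n : ℤ) :
    ContMDiff (𝓡∂ 2) 𝓘(ℝ, (ι → ℝ) × (ι → ℝ)) ∞ (heightWeights P φ n) :=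
  (contMDiff_pi_space.2 fun i => (hP i).comp (contMDiff_zpow φ n)).prodMk_space
    (contMDiff_pi_space.2 fun i => (hP i).comp (contMDiff_zpow φ (n - 1)))

variable (P) in
lemma exists_eventually_suspensionHeight_eq (hκ : ∀ g, Monotone (κ g))
    (hψ : ∀ e, p (ψ e) = φ (p e)) (e : E) (t : ℝ) : ∃ g g' : ι → G, ∀ᶠ z in 𝓝 (e, t),
      suspensionHeight P κ ψ z.1 z.2 =
        localHeight κ g g' ⌊t⌋ (heightWeights P φ ⌊t⌋ (p z.1), z.2) := by
  have eventually_iterate (k : ℤ) {A : E → Prop} (hA : ∀ᶠ e' in 𝓝 ((ψ ^ k) e), A e') :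
      ∀ᶠ z in 𝓝 (e, t), A ((ψ ^ k) z.1) :=
    (((ψ ^ k).continuous.comp continuous_fst).continuousAt (x := (e, t))).eventually hA
  obtain ⟨g, hg⟩ := exists_eventually_fiberHeight_eq P κ ((ψ ^ ⌊t⌋) e)
  obtain ⟨g', hg'⟩ := exists_eventually_fiberHeight_eq P κ ((ψ ^ (⌊t⌋ - 1)) e)
  have near : ∀ᶠ z : E × ℝ in 𝓝 (e, t), z.2 ∈ Ioo ((⌊t⌋ : ℝ) - 1) (⌊t⌋ + 1) :=
    continuous_snd.continuousAt.eventually (isOpen_Ioo.mem_nhds (mem_Ioo_floor t))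
  refine ⟨g, g', ?_⟩
  filter_upwards [eventually_iterate _ hg, eventually_iterate _ hg', near] with z upper lower hz
  rw [suspensionHeight_eq_on_Ioo P ψ hκ z.1 hz, upper, lower, proj_zpow (χ := φ.toEquiv) hψ,
    proj_zpow (χ := φ.toEquiv) hψ]
  rfl

lemma exists_contMDiffAt_suspensionHeight (hP : ∀ i, ContMDiff (𝓡∂ 2) 𝓘(ℝ, ℝ) ∞ (P.weight i))
    (hκ : ∀ g, Monotone (κ g)) (hψ : ∀ e, p (ψ e) = φ (p e))
    (tapered : ∀ g, IsTaperedDiffeo (κ g)) (e : E) (t : ℝ) :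
    ∃ F K : S × ℝ → ℝ,
      ContMDiffAt ((𝓡∂ 2).prod 𝓘(ℝ, ℝ)) 𝓘(ℝ, ℝ) ∞ F (p e, t) ∧
      ContMDiffAt ((𝓡∂ 2).prod 𝓘(ℝ, ℝ)) 𝓘(ℝ, ℝ) ∞ K (p e, F (p e, t)) ∧
      (∀ᶠ z in 𝓝 (e, t), suspensionHeight P κ ψ z.1 z.2 = F (p z.1, z.2)) ∧
      ∀ᶠ z in 𝓝 (p e, t), K (z.1, F z) = z.2 := by
  obtain ⟨g, g', height_eq⟩ := exists_eventually_suspensionHeight_eq P hκ hψ e t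
  obtain ⟨a, ha₀, ha⟩ := exists_hasDerivAt_localHeight hκ tapered g g' (Int.floor_le t)
    (fun i => P.nonneg i _) (P.sum_eq_one (((φ.toEquiv : Equiv.Perm S) ^ ⌊t⌋) (p e)))
    (P.sum_eq_one (((φ.toEquiv : Equiv.Perm S) ^ (⌊t⌋ - 1)) (p e)))
  have contDiff_localHeight := contDiff_localHeight hκ tapered g g' ⌊t⌋
  obtain ⟨K, contDiffAt_K, K_localHeight⟩ :=
    exists_contDiffAt_inverse contDiff_localHeight.contDiffAt ha ha₀
  have contMDiffAt_weights (z : S × ℝ) :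
      ContMDiffAt ((𝓡∂ 2).prod 𝓘(ℝ, ℝ)) 𝓘(ℝ, ((ι → ℝ) × (ι → ℝ)) × ℝ) ∞
        (fun z : S × ℝ => (heightWeights P φ ⌊t⌋ z.1, z.2)) z :=
    (((contMDiff_heightWeights hP ⌊t⌋).comp contMDiff_fst).prodMk_space contMDiff_snd).contMDiffAt
  exact ⟨fun z => localHeight κ g g' ⌊t⌋ (heightWeights P φ ⌊t⌋ z.1, z.2),
    fun z => K (heightWeights P φ ⌊t⌋ z.1, z.2),
    contDiff_localHeight.contDiffAt.contMDiffAt.comp (p e, t) (contMDiffAt_weights _),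
    contDiffAt_K.contMDiffAt.comp (f := fun z : S × ℝ => (heightWeights P φ ⌊t⌋ z.1, z.2)) (p e, _)
      (contMDiffAt_weights _), height_eq,
    (contMDiffAt_weights (p e, t)).continuousAt.eventually K_localHeight⟩

end SmoothSuspension

lemma exists_contMDiffAt_leftInverse {V V' H H' M M' : Type*} [NormedAddCommGroup V]
    [NormedSpace ℝ V] [NormedAddCommGroup V'] [NormedSpace ℝ V'] [TopologicalSpace H]
    [TopologicalSpace H'] {J : ModelWithCorners ℝ V H} {J' : ModelWithCorners ℝ V' H'}
    [TopologicalSpace M] [ChartedSpace H M] [TopologicalSpace M'] [ChartedSpace H' M'] {r : ℕ∞ω}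
    {f : M → M'} {x : M} (hf : IsLocalDiffeomorphAt J J' r f x) :
    ∃ g : M' → M, ContMDiffAt J' J r g (f x) ∧ ∀ᶠ y in 𝓝 x, g (f y) = y :=
  ⟨hf.localInverse, hf.localInverse_contMDiffAt, hf.localInverse_eventuallyEq_left⟩

section SmoothFoliation

variable {S N E G ι : Type*} [TopologicalSpace S] [ChartedSpace (EuclideanHalfSpace 2) S]
  [TopologicalSpace N] [ChartedSpace HalfSpaceProd N] [TopologicalSpace E] [Group G]
  [MulAction G E] [Fintype ι] {p : E → S} {e₀ : E} {P : SheetPartition G p e₀ ι}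
  {κ : G →* (I ≃ₜ I)} {ψ : E ≃ₜ E} {φ : S ≃ₘ^∞⟮𝓡∂ 2, 𝓡∂ 2⟯ S} {q : S × ℝ → N}
  (hP : ∀ i, ContMDiff (𝓡∂ 2) 𝓘(ℝ, ℝ) ∞ (P.weight i)) (hκ : ∀ g, Monotone (κ g))
  (hψ : ∀ e, p (ψ e) = φ (p e)) (tapered : ∀ g, IsTaperedDiffeo (κ g)) (hq : IsMappingTorus φ q)
  {Φ : OpenPartialHomeomorph (E × ℝ) N} (hΦ : EqOn Φ (developingMap P κ ψ q) Φ.source)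
  {Θ : OpenPartialHomeomorph E S} (hΘ : EqOn Θ p Θ.source)
  {D : OpenPartialHomeomorph S (EuclideanHalfSpace 2)}
  (hD : D ∈ IsManifold.maximalAtlas (𝓡∂ 2) ∞ S)
include hP hκ hψ tapered hq hΦ hΘ hD

lemma contMDiffAt_foliatedChart (continuous_p : Continuous p) {e : E} {t : ℝ}
    (hz : (e, t) ∈ Φ.source) (he : e ∈ Θ.source) (he' : p e ∈ D.source) :
    ContMDiffAt (M' := HalfSpaceProd) ((𝓡∂ 2).prod 𝓘(ℝ, ℝ)) ((𝓡∂ 2).prod 𝓘(ℝ, ℝ)) ∞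
      (foliatedChart Φ (Θ.trans D)) (developingMap P κ ψ q (e, t)) := by
  obtain ⟨F, K, contMDiffAt_F, contMDiffAt_K, height_eq, K_F⟩ :=
    exists_contMDiffAt_suspensionHeight hP hκ hψ tapered e t
  obtain ⟨qInv, contMDiffAt_qInv, qInv_eq⟩ :=
    exists_contMDiffAt_leftInverse (hq.localDiffeo (p e, F (p e, t)))
  have qInv_q : qInv (q (p e, F (p e, t))) = (p e, F (p e, t)) := qInv_eq.self_of_nhds
  have continuous_proj : Continuous fun z : E × ℝ => (p z.1, z.2) := by fun_prop
  have continuousAt_F : ContinuousAt (fun z : E × ℝ => (p z.1, F (p z.1, z.2))) (e, t) :=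
    (continuous_p.comp continuous_fst).continuousAt.prodMk (contMDiffAt_F.continuousAt.comp
      (x := (e, t)) (f := fun z : E × ℝ => (p z.1, z.2)) continuous_proj.continuousAt)
  refine ContMDiffAt.congr_of_eventuallyEq (M' := HalfSpaceProd)
    (f := fun y => (D (qInv y).1, K (qInv y))) ?_ ?_
  · rw [developingMap, height_eq.self_of_nhds]
    refine contMDiffAt_prodMk_halfSpaceProd
      (ContMDiffAt.comp (g := fun z : S × ℝ => D z.1) _ ?_ contMDiffAt_qInv)
      (ContMDiffAt.comp (g := K) _ (by rwa [qInv_q]) contMDiffAt_qInv)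
    rw [qInv_q]
    exact (contMDiffAt_of_mem_maximalAtlas hD he').comp (p e, F (p e, t)) contMDiffAt_fst
  · rw [EventuallyEq, ← hΦ hz, ← Φ.map_nhds_eq hz, eventually_map]
    filter_upwards [Φ.open_source.mem_nhds hz, height_eq,
      continuous_fst.continuousAt.eventually (Θ.open_source.mem_nhds he),
      continuous_proj.continuousAt.eventually K_F,
      continuousAt_F.eventually qInv_eq]
      with z hz height_z mem_Θ K_z qInv_z
    rw [hΦ hz, foliatedChart_apply hΦ _ hz, developingMap, height_z, qInv_z, K_z,
      OpenPartialHomeomorph.trans_apply, hΘ mem_Θ]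

lemma contMDiffAt_foliatedChart_symm {w : HalfSpaceProd}
    (hw : w ∈ (foliatedChart Φ (Θ.trans D)).target) :
    ContMDiffAt (M := HalfSpaceProd) ((𝓡∂ 2).prod 𝓘(ℝ, ℝ)) ((𝓡∂ 2).prod 𝓘(ℝ, ℝ)) ∞
      (foliatedChart Φ (Θ.trans D)).symm w := by
  obtain ⟨⟨mem_D, mem_Θ⟩, mem_Φ⟩ : (w.1 ∈ D.target ∧ D.symm w.1 ∈ Θ.target) ∧
      (Θ.symm (D.symm w.1), w.2) ∈ Φ.source := by
    simp only [foliatedChart, OpenPartialHomeomorph.trans_target,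
      OpenPartialHomeomorph.prod_target, OpenPartialHomeomorph.symm_target, mem_inter_iff,
      mem_preimage] at hw
    exact ⟨hw.1.1, hw.2⟩
  have p_symm {x : S} (hx : x ∈ Θ.target) : p (Θ.symm x) = x := by
    rw [← hΘ (Θ.map_target hx), Θ.right_inv hx]
  obtain ⟨F, -, contMDiffAt_F, -, height_eq, -⟩ :=
    exists_contMDiffAt_suspensionHeight hP hκ hψ tapered (Θ.symm (D.symm w.1)) w.2
  rw [p_symm mem_Θ] at contMDiffAt_F
  have contMDiffAt_base : ContMDiffAt ((𝓡∂ 2).prod 𝓘(ℝ, ℝ)) (𝓡∂ 2) ∞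
      (fun w : HalfSpaceProd => D.symm w.1) w :=
    ContMDiffAt.comp (g := D.symm) w (contMDiffAt_symm_of_mem_maximalAtlas hD mem_D)
      contMDiffAt_fst_halfSpaceProd
  have contMDiffAt_pair : ContMDiffAt ((𝓡∂ 2).prod 𝓘(ℝ, ℝ)) ((𝓡∂ 2).prod 𝓘(ℝ, ℝ)) ∞
      (fun w : HalfSpaceProd => (D.symm w.1, w.2)) w :=
    contMDiffAt_base.prodMk contMDiffAt_snd_halfSpaceProd
  have continuousAt_lift :
      ContinuousAt (fun w : HalfSpaceProd => (Θ.symm (D.symm w.1), w.2)) w :=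
    ((Θ.symm.continuousAt mem_Θ).comp (x := w) (f := fun w : HalfSpaceProd => D.symm w.1)
      contMDiffAt_base.continuousAt).prodMk continuous_snd.continuousAt
  refine ContMDiffAt.congr_of_eventuallyEq
    (f := fun w : HalfSpaceProd => q (D.symm w.1, F (D.symm w.1, w.2)))
    ((hq.localDiffeo _).contMDiffAt.comp w
      (contMDiffAt_base.prodMk (contMDiffAt_F.comp w contMDiffAt_pair))) ?_
  filter_upwards [continuousAt_lift.eventually height_eq,
    continuousAt_lift.eventually (Φ.open_source.mem_nhds mem_Φ),
    contMDiffAt_base.continuousAt.eventually (Θ.open_target.mem_nhds mem_Θ)]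
    with w' height_w' mem_Φ' mem_Θ'
  change Φ (Θ.symm (D.symm w'.1), w'.2) = _
  rw [hΦ mem_Φ', developingMap, height_w']
  dsimp only
  rw [p_symm mem_Θ']

omit hΦ hΘ hD in
lemma isSmooth_foliation [IsManifold (𝓡∂ 2) ∞ S] [IsManifold ((𝓡∂ 2).prod 𝓘(ℝ, ℝ)) ∞ N]
    (continuous_p : Continuous p) (h𝒞 : ∀ e, ∃ C ∈ liftedCharts p, e ∈ C.source)
    (hQ : IsFoliatedCover (developingMap P κ ψ q)) : (hQ.foliation h𝒞).IsSmooth := by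
  rintro _ ⟨Φ, hΦ, _, ⟨Θ, hΘ, D, hD, rfl⟩, rfl⟩
  have hD' : D ∈ IsManifold.maximalAtlas (𝓡∂ 2) ∞ S := IsManifold.subset_maximalAtlas hD
  refine OpenPartialHomeomorph.mem_maximalAtlas_of_contMDiffOn _ (fun y hy => ?_) fun w hw =>
    (contMDiffAt_foliatedChart_symm hP hκ hψ tapered hq hΦ hΘ hD' hw).contMDiffWithinAt
  obtain ⟨⟨e, t⟩, hz, he, rfl⟩ := (mem_foliatedChart_source hΦ).1 hy
  rw [OpenPartialHomeomorph.trans_source] at he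
  exact (contMDiffAt_foliatedChart hP hκ hψ tapered hq hΦ hΘ hD' continuous_p hz he.1
    (hΘ he.1 ▸ he.2)).contMDiffWithinAt

end SmoothFoliation

theorem lemma4p3_general {S : Type*} {N : Type u}
    [TopologicalSpace S] [CompactSpace S] [T2Space S]
    [ChartedSpace (EuclideanHalfSpace 2) S] [IsManifold (𝓡∂ 2) ∞ S]
    {G E : Type*} [Group G] [Small.{u} E] [TopologicalSpace E] [ContractibleSpace E] [MulAction G E]
    {p : E → S} (hp : IsQuotientCoveringMap p G) (φ : S ≃ₘ^∞⟮𝓡∂ 2, 𝓡∂ 2⟯ S)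
    [TopologicalSpace N] [ChartedSpace HalfSpaceProd N]
    [IsManifold ((𝓡∂ 2).prod 𝓘(ℝ, ℝ)) ∞ N]
    (q : S × ℝ → N) (hq : IsMappingTorus φ q)
    (x₀ : S) (ρ : FundamentalGroup S x₀ →* (I ≃ₜ I)) (hmono : ∀ γ, Monotone (ρ γ)) :
    ∃ F : SurfaceFoliation N, (IsGeneric ρ → F.IsTypical) ∧ F.IsSuspension q ρ ∧
      ((∀ γ, IsTaperedDiffeo (ρ γ)) → F.IsSmooth) := by
  have := t2Space_of_isCoveringMap hp.isCoveringMap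
  obtain ⟨e₀, rfl⟩ := hp.surjective x₀
  obtain ⟨κ, rfl⟩ : ∃ κ : G →* (I ≃ₜ I),
      κ.comp (fundamentalGroupEquivDeck hp e₀).toMonoidHom = ρ :=
    ⟨ρ.comp (fundamentalGroupEquivDeck hp e₀).symm.toMonoidHom, by ext; simp⟩
  have deck_surjective := (fundamentalGroupEquivDeck hp e₀).surjective
  have hκ : ∀ g, Monotone (κ g) := deck_surjective.forall.2 hmono
  obtain ⟨T, P, hP⟩ := exists_contMDiff_sheetPartition (𝓡∂ 2) hp e₀
  obtain ⟨ψ, hψ⟩ := exists_homeomorph_lift hp φ.toHomeomorph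
  choose c hc using fun n : ℤ => exists_monoidHom_smul hp (ψ ^ n).continuous
    (proj_zpow (χ := φ.toEquiv) hψ n)
  have hQ := isFoliatedCover_developingMap P hp hκ hψ hc hq
  have h𝒞 := exists_mem_liftedCharts hp.isCoveringMap.isLocalHomeomorph
  refine ⟨hQ.foliation h𝒞, fun generic => hQ.isTypical h𝒞 ?_,
    isSuspension_foliation P hp hκ hc h𝒞 hQ, fun tapered => isSmooth_foliation hP hκ hψ
      (deck_surjective.forall.2 tapered) hq hp.isCoveringMap.continuous h𝒞 hQ⟩
  refine hasFaithfulHolonomy_developingMap P hp hκ hψ hc hq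
    (deck_surjective.forall.2 fun γ hγ => generic γ fun h => hγ ?_)
  rw [h, map_one]

end

theorem lemma4p3 {S N : Type*}
    [TopologicalSpace S] [ChartedSpace (EuclideanHalfSpace 2) S] [IsManifold (𝓡∂ 2) ∞ S]
    (hS : IsPuncturedSurface S)
    (φ : S ≃ₘ^∞⟮𝓡∂ 2, 𝓡∂ 2⟯ S)
    [TopologicalSpace N] [ChartedSpace HalfSpaceProd N]
    [IsManifold ((𝓡∂ 2).prod 𝓘(ℝ, ℝ)) ∞ N]
    (q : S × ℝ → N) (hq : IsMappingTorus φ q)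
    (x₀ : S) (ρ : FundamentalGroup S x₀ →* (I ≃ₜ I))
    (hmono : ∀ γ, Monotone (ρ γ)) (hρ : IsGeneric ρ) :
    ∃ F : SurfaceFoliation N,
      F.IsTypical ∧ F.IsSuspension q ρ ∧ (IsWellTapered ρ → F.IsSmooth) := by
  obtain ⟨_, _, G, _, E, _, _, p, _, hp⟩ := hS.exists_contractible_covering
  obtain ⟨F, typical, suspension, smooth⟩ := lemma4p3_general hp φ q hq x₀ ρ hmono
  exact ⟨F, typical hρ, suspension, fun tapered => smooth tapered.2⟩
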